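/- Let $R$ be a commutative ring (for instance $\mathbb{C}$, or $\mathbb{C}[q^{\pm1},v_1,\dots,v_m]$ with $q,v_1,\dots,v_m$ indeterminates), let $m,n\ge 0$ be integers, let $q\in R$ be invertible and let $v_1,\dots,v_m\in R$. The cyclotomic Hecke algebra $H(m,1,n)$ is the associative unital $R$-algebra with generators $\tau,\sigma_1,\dots,\sigma_{n-1}$ (no generators if $n=0$, so that $H(m,1,0)=R$) and relations \begin{align*} &\sigma_i\sigma_{i+1}\sigma_i=\sigma_{i+1}\sigma_i\sigma_{i+1}\ (1\le i\le n-2),\qquad \sigma_i\sigma_j=\sigma_j\sigma_i\ (|i-j|>1),\\ &\tau\sigma_1\tau\sigma_1=\sigma_1\tau\sigma_1\tau,\qquad \tau\sigma_i=\sigma_i\tau\ (i>1),\\ &\sigma_i^2=(q-q^{-1})\sigma_i+1\ (1\le i\le n-1),\qquad (\tau-v_1)\cdots(\tau-v_m)=0 . \end{align*} In particular every $\sigma_i$ is invertible. If all $v_a$ are invertible then so is $\tau$, and $H(m,1,n)$ is the quotient of the group algebra over $R$ of the braid group of type $B$ by the last two families of relations. For $k=1,\dots,n$ let $$R_k=\{\sigma_j^{-1}\sigma_{j-1}^{-1}\cdots\sigma_1^{-1}\,\tau^{\alpha}\,\sigma_1\sigma_2\cdots\sigma_{k-1}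 : 0\le j\le k-1,\ 0\le\alpha\le m-1\},$$ regarded as a family indexed by the pairs $(j,\alpha)$. Then every element of $H(m,1,n)$ can be written uniquely as a linear combination, with coefficients in $R$, of the products $u_nu_{n-1}\cdots u_1$ with $u_k\in R_k$ for $k=1,\dots,n$; that is, these products, indexed by the choices of a pair $(j_k,\alpha_k)$ for each $k$, form a basis of the $R$-module $H(m,1,n)$. -/

import Mathlib

namespace CyclotomicHecke

/-- The generators of `H(m,1,n)`: `τ` (present as soon as `1 ≤ n`) and `σ_1, …, σ_{n-1}`. -/
inductive Gen (n : ℕ) : Type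
  | tau (h : 1 ≤ n) : Gen n
  | sigma (i : ℕ) (h₁ : 1 ≤ i) (h₂ : i < n) : Gen n

section Presentation

variable {R : Type*} [CommRing R] {m : ℕ}

/-- The generator `τ` in the free algebra. -/
def freeTau (R : Type*) [CommRing R] {n : ℕ} (h : 1 ≤ n) : FreeAlgebra R (Gen n) :=
  FreeAlgebra.ι R (Gen.tau h)

/-- The generator `σ_i` in the free algebra. -/
def freeSigma (R : Type*) [CommRing R] {n : ℕ} (i : ℕ) (h₁ : 1 ≤ i) (h₂ : i < n) :
    FreeAlgebra R (Gen n) :=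
  FreeAlgebra.ι R (Gen.sigma i h₁ h₂)

/-- The defining relations of `H(m,1,n)` with parameters `q, v_1, …, v_m`. -/
inductive Rel (q : Rˣ) (v : Fin m → R) (n : ℕ) :
    FreeAlgebra R (Gen n) → FreeAlgebra R (Gen n) → Prop
  | braid (i : ℕ) (h₁ : 1 ≤ i) (h₂ : i + 1 < n) :
      Rel q v n
        (freeSigma R i h₁ (by omega) * freeSigma R (i + 1) (by omega) h₂ *
          freeSigma R i h₁ (by omega))
        (freeSigma R (i + 1) (by omega) h₂ * freeSigma R i h₁ (by omega) *
          freeSigma R (i + 1) (by omega) h₂)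
  | comm (i j : ℕ) (hi₁ : 1 ≤ i) (hi₂ : i < n) (hj₁ : 1 ≤ j) (hj₂ : j < n)
      (hij : 1 < |(i : ℤ) - (j : ℤ)|) :
      Rel q v n
        (freeSigma R i hi₁ hi₂ * freeSigma R j hj₁ hj₂)
        (freeSigma R j hj₁ hj₂ * freeSigma R i hi₁ hi₂)
  | tau_braid (h : 1 < n) :
      Rel q v n
        (freeTau R h.le * freeSigma R 1 le_rfl h * freeTau R h.le * freeSigma R 1 le_rfl h)
        (freeSigma R 1 le_rfl h * freeTau R h.le * freeSigma R 1 le_rfl h * freeTau R h.le)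
  | tau_comm (i : ℕ) (h₁ : 1 < i) (h₂ : i < n) :
      Rel q v n
        (freeTau R (by omega) * freeSigma R i h₁.le h₂)
        (freeSigma R i h₁.le h₂ * freeTau R (by omega))
  | quadratic (i : ℕ) (h₁ : 1 ≤ i) (h₂ : i < n) :
      Rel q v n
        (freeSigma R i h₁ h₂ ^ 2)
        (((q : R) - ((q⁻¹ : Rˣ) : R)) • freeSigma R i h₁ h₂ + 1)
  | cyclotomic (h : 1 ≤ n) :
      Rel q v n
        (List.ofFn fun a : Fin m => freeTau R h - algebraMap R _ (v a)).prod
        0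

end Presentation

end CyclotomicHecke

/-- The cyclotomic Hecke algebra `H(m,1,n)` over the commutative ring `R`, with parameters an
invertible `q` and `v_1, …, v_m`, given by generators and relations. The generators `σ_i` are
invertible by the quadratic relation; `τ` is invertible whenever all `v_a` are, and then the algebra
is the quotient of the group algebra of the type B braid group, see
`CyclotomicHecke.exists_equiv_groupQuotient`. -/
abbrev CyclotomicHecke {R : Type*} [CommRing R] {m : ℕ} (q : Rˣ) (v : Fin m → R) (n : ℕ) : Type _ :=
  RingQuot (CyclotomicHecke.Rel q v n)

namespace CyclotomicHecke

section Elements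

variable {R : Type*} [CommRing R] {m : ℕ} (q : Rˣ) (v : Fin m → R) {n : ℕ}

/-- The element `τ` of `H(m,1,n)`. -/
def tau (h : 1 ≤ n) : CyclotomicHecke q v n :=
  RingQuot.mkAlgHom R (Rel q v n) (freeTau R h)

/-- The element `σ_i` of `H(m,1,n)`, not yet as a unit. -/
def sigmaElt (i : ℕ) (h₁ : 1 ≤ i) (h₂ : i < n) : CyclotomicHecke q v n :=
  RingQuot.mkAlgHom R (Rel q v n) (freeSigma R i h₁ h₂)

theorem sigmaElt_sq (i : ℕ) (h₁ : 1 ≤ i) (h₂ : i < n) :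
    sigmaElt q v i h₁ h₂ ^ 2 =
      ((q : R) - ((q⁻¹ : Rˣ) : R)) • sigmaElt q v i h₁ h₂ + 1 := by
  have h := RingQuot.mkAlgHom_rel R (Rel.quadratic (q := q) (v := v) i h₁ h₂)
  simp only [map_pow, map_add, map_smul, map_one] at h
  exact h

/-- The invertible element `σ_i` of `H(m,1,n)`, with inverse `σ_i - (q - q⁻¹)`. -/
def sigma (i : ℕ) (h₁ : 1 ≤ i) (h₂ : i < n) : (CyclotomicHecke q v n)ˣ where
  val := sigmaElt q v i h₁ h₂
  inv := sigmaElt q v i h₁ h₂ - ((q : R) - ((q⁻¹ : Rˣ) : R)) • 1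
  val_inv := by
    rw [mul_sub, mul_smul_comm, mul_one, ← pow_two, sigmaElt_sq, add_sub_cancel_left]
  inv_val := by
    rw [sub_mul, smul_mul_assoc, one_mul, ← pow_two, sigmaElt_sq, add_sub_cancel_left]

/-- `σ_j⁻¹ σ_{j-1}⁻¹ ⋯ σ_1⁻¹`, for `j ≤ n - 1`. -/
def descInv : (j : ℕ) → j < n → CyclotomicHecke q v n
  | 0, _ => 1
  | j + 1, h =>
      (((sigma q v (j + 1) (Nat.succ_pos j) h)⁻¹ : (CyclotomicHecke q v n)ˣ) :
        CyclotomicHecke q v n) * descInv j (by omega)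

/-- `σ_1 σ_2 ⋯ σ_j`, for `j ≤ n - 1`. -/
def asc : (j : ℕ) → j < n → CyclotomicHecke q v n
  | 0, _ => 1
  | j + 1, h =>
      asc j (by omega) * (sigma q v (j + 1) (Nat.succ_pos j) h : CyclotomicHecke q v n)

/-- The element `σ_j⁻¹ ⋯ σ_1⁻¹ τ^α σ_1 σ_2 ⋯ σ_{k-1}` of the set `R_k`, where
`1 ≤ k ≤ n`, `0 ≤ j ≤ k - 1` and `0 ≤ α ≤ m - 1`. -/
def factor (k : ℕ) (h₁ : 1 ≤ k) (h₂ : k ≤ n) (j : Fin k) (α : Fin m) : CyclotomicHecke q v n :=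
  descInv q v j.val (by omega) * tau q v (by omega) ^ α.val * asc q v (k - 1) (by omega)

/-- A choice of an element of `R_k` (that is, of the pair `(j, α)`) for every `k = 1, …, n`.
The component at `i : Fin n` belongs to `k = i + 1`. -/
abbrev Choice (m n : ℕ) : Type := (i : Fin n) → Fin (i.val + 1) × Fin m

/-- The product `u_n u_{n-1} ⋯ u_1`, with the `u_k ∈ R_k` given by a choice of pairs. -/
def normalWord (c : Choice m n) : CyclotomicHecke q v n :=
  (List.ofFn fun i : Fin n =>
    factor q v (i.val + 1) (Nat.succ_pos _) i.isLt (c i).1 (c i).2).reverse.prod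

end Elements

/-! Comparison with the construction as a quotient of the group algebra of the type B braid
group. -/

section GroupQuotient

/-- The relators of the braid group of type B. -/
inductive BraidRelator (n : ℕ) : FreeGroup (Gen n) → Prop
  | braid (i : ℕ) (h₁ : 1 ≤ i) (h₂ : i + 1 < n) (a b : FreeGroup (Gen n))
      (ha : a = FreeGroup.of (Gen.sigma i h₁ (by omega)))
      (hb : b = FreeGroup.of (Gen.sigma (i + 1) (by omega) h₂)) :
      BraidRelator n (a * b * a * (b * a * b)⁻¹)
  | comm (i j : ℕ) (hi₁ : 1 ≤ i) (hi₂ : i < n) (hj₁ : 1 ≤ j) (hj₂ : j < n)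
      (hij : 1 < |(i : ℤ) - (j : ℤ)|) (a b : FreeGroup (Gen n))
      (ha : a = FreeGroup.of (Gen.sigma i hi₁ hi₂))
      (hb : b = FreeGroup.of (Gen.sigma j hj₁ hj₂)) :
      BraidRelator n (a * b * (b * a)⁻¹)
  | tau_braid (h : 1 < n) (t a : FreeGroup (Gen n))
      (ht : t = FreeGroup.of (Gen.tau h.le))
      (ha : a = FreeGroup.of (Gen.sigma 1 le_rfl h)) :
      BraidRelator n (t * a * t * a * (a * t * a * t)⁻¹)
  | tau_comm (i : ℕ) (h₁ : 1 < i) (h₂ : i < n) (t a : FreeGroup (Gen n))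
      (ht : t = FreeGroup.of (Gen.tau (by omega)))
      (ha : a = FreeGroup.of (Gen.sigma i h₁.le h₂)) :
      BraidRelator n (t * a * (a * t)⁻¹)

/-- The braid group of type B. -/
abbrev BraidGroupB (n : ℕ) : Type := PresentedGroup {w | BraidRelator n w}

variable {R : Type*} [CommRing R] {m : ℕ}

/-- A generator of the braid group, in the group algebra. -/
noncomputable def groupGen (R : Type*) [CommRing R] {n : ℕ} (g : Gen n) : MonoidAlgebra R (BraidGroupB n) :=
  MonoidAlgebra.of R (BraidGroupB n) (PresentedGroup.of g)

/-- The quadratic relations, which define the affine Hecke algebra. -/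
inductive AffineRel (q : Rˣ) (n : ℕ) :
    MonoidAlgebra R (BraidGroupB n) → MonoidAlgebra R (BraidGroupB n) → Prop
  | quadratic (i : ℕ) (h₁ : 1 ≤ i) (h₂ : i < n) :
      AffineRel q n
        (groupGen R (Gen.sigma i h₁ h₂) ^ 2)
        (((q : R) - ((q⁻¹ : Rˣ) : R)) • groupGen R (Gen.sigma i h₁ h₂) + 1)

/-- The affine Hecke algebra. -/
abbrev AffineHecke (q : Rˣ) (n : ℕ) : Type _ := RingQuot (AffineRel q n)

/-- A generator of the affine Hecke algebra. -/
noncomputable def affineGen (q : Rˣ) {n : ℕ} (g : Gen n) : AffineHecke q n :=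
  RingQuot.mkAlgHom R (AffineRel q n) (groupGen R g)

/-- The relation `(τ - v_1) ⋯ (τ - v_m) = 0` in the affine Hecke algebra. -/
inductive CyclotomicRel (q : Rˣ) (v : Fin m → R) (n : ℕ) :
    AffineHecke q n → AffineHecke q n → Prop
  | cyclotomic (h : 1 ≤ n) :
      CyclotomicRel q v n
        (List.ofFn fun a : Fin m => affineGen q (Gen.tau h) - algebraMap R _ (v a)).prod 0

/-- The cyclotomic quotient of the affine Hecke algebra. -/
abbrev GroupQuotient (q : Rˣ) (v : Fin m → R) (n : ℕ) : Type _ :=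
  RingQuot (CyclotomicRel q v n)

/-- A generator of the cyclotomic quotient of the affine Hecke algebra. -/
noncomputable def quotientGen (q : Rˣ) (v : Fin m → R) {n : ℕ} (g : Gen n) : GroupQuotient q v n :=
  RingQuot.mkAlgHom R (CyclotomicRel q v n) (affineGen q g)

theorem cyclotomic_eq (q : Rˣ) (v : Fin m → R) {n : ℕ} (h : 1 ≤ n) :
    (List.ofFn fun a : Fin m =>
      tau q v h - algebraMap R (CyclotomicHecke q v n) (v a)).prod = 0 := by
  have h' := RingQuot.mkAlgHom_rel R (Rel.cyclotomic (q := q) (v := v) h)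
  rw [map_zero, map_list_prod, List.map_ofFn] at h'
  rw [← h']
  congr 2
  funext a
  simp only [Function.comp, map_sub, AlgHom.commutes]
  rfl

theorem isUnit_tau (q : Rˣ) (v : Fin m → R) {n : ℕ} (hv : ∀ a, IsUnit (v a)) (h : 1 ≤ n) :
    IsUnit (tau q v h) := by
  set p : Polynomial R :=
    (List.ofFn fun a : Fin m => Polynomial.X - Polynomial.C (v a)).prod with hp
  have h0 : Polynomial.aeval (tau q v h) p = 0 := by
    rw [hp, map_list_prod, List.map_ofFn, ← cyclotomic_eq q v h]
    congr 2
    funext a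
    simp only [Function.comp, map_sub, Polynomial.aeval_X, Polynomial.aeval_C]
  have hc : IsUnit (p.coeff 0) := by
    have : p.coeff 0 = ∏ a, (-v a) := by
      rw [Polynomial.coeff_zero_eq_eval_zero, hp, List.prod_ofFn, Polynomial.eval_prod]
      simp
    rw [this, IsUnit.prod_univ_iff]
    exact fun a => (hv a).neg
  obtain ⟨u, hu⟩ := hc
  have key : tau q v h * Polynomial.aeval (tau q v h) p.divX =
      algebraMap R _ (-(u : R)) := by
    have e := congrArg (Polynomial.aeval (tau q v h)) (Polynomial.X_mul_divX_add p)
    rw [map_add, map_mul, Polynomial.aeval_X, Polynomial.aeval_C, h0, ← hu] at e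
    rw [map_neg]
    exact eq_neg_of_add_eq_zero_left e
  have hcomm : Commute (tau q v h) (Polynomial.aeval (tau q v h) p.divX) := by
    have e : Polynomial.X * p.divX = p.divX * Polynomial.X := mul_comm _ _
    have e' := congrArg (Polynomial.aeval (tau q v h)) e
    simp only [map_mul, Polynomial.aeval_X] at e'
    exact e'
  have hu' : IsUnit (tau q v h * Polynomial.aeval (tau q v h) p.divX) := by
    rw [key]
    exact (u.isUnit.neg).map (algebraMap R _)
  exact (hcomm.isUnit_mul_iff.mp hu').1

/-- A generator of `H(m,1,n)` as a unit, when the `v_a` are invertible. -/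
noncomputable def unitGen (q : Rˣ) (v : Fin m → R) {n : ℕ} (hv : ∀ a, IsUnit (v a)) :
    Gen n → (CyclotomicHecke q v n)ˣ
  | Gen.tau h => (isUnit_tau q v hv h).unit
  | Gen.sigma i h₁ h₂ => sigma q v i h₁ h₂

theorem unitGen_val (q : Rˣ) (v : Fin m → R) {n : ℕ} (hv : ∀ a, IsUnit (v a)) (g : Gen n) :
    (unitGen q v hv g : CyclotomicHecke q v n) =
      RingQuot.mkAlgHom R (Rel q v n) (FreeAlgebra.ι R g) := by
  cases g <;> rfl

theorem unitGen_relator (q : Rˣ) (v : Fin m → R) {n : ℕ} (hv : ∀ a, IsUnit (v a)) :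
    ∀ w ∈ {w | BraidRelator n w}, FreeGroup.lift (unitGen q v hv) w = 1 := by
  rintro w (⟨i, h₁, h₂, a, b, rfl, rfl⟩ | ⟨i, j, hi₁, hi₂, hj₁, hj₂, hij, a, b, rfl, rfl⟩ |
    ⟨h, t, a, rfl, rfl⟩ | ⟨i, h₁, h₂, t, a, rfl, rfl⟩)
  all_goals
    rw [map_mul, map_inv, mul_inv_eq_one]
    simp only [map_mul, FreeGroup.lift_apply_of]
    apply Units.ext
    simp only [Units.val_mul, unitGen_val, ← map_mul]
    apply RingQuot.mkAlgHom_rel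
  · exact Rel.braid i h₁ h₂
  · exact Rel.comm i j hi₁ hi₂ hj₁ hj₂ hij
  · exact Rel.tau_braid h
  · exact Rel.tau_comm i h₁ h₂

theorem groupGen_relation {n : ℕ} {a b : FreeGroup (Gen n)} (h : BraidRelator n (a * b⁻¹)) :
    MonoidAlgebra.of R (BraidGroupB n) (PresentedGroup.mk {w | BraidRelator n w} a) =
      MonoidAlgebra.of R (BraidGroupB n) (PresentedGroup.mk {w | BraidRelator n w} b) := by
  congr 1
  have := PresentedGroup.mk_eq_one_iff.mpr
    (Subgroup.subset_normalClosure (s := {w | BraidRelator n w}) h)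
  rwa [map_mul, map_inv, mul_inv_eq_one] at this

/-- The algebra map from the presented algebra to the quotient of the group algebra. -/
noncomputable def toGroupQuotient (q : Rˣ) (v : Fin m → R) (n : ℕ) :
    CyclotomicHecke q v n →ₐ[R] GroupQuotient q v n :=
  RingQuot.liftAlgHom R ⟨FreeAlgebra.lift R (quotientGen q v), by
    have rel {a b : FreeGroup (Gen n)} (h : BraidRelator n (a * b⁻¹)) :=
      congrArg (fun z => RingQuot.mkAlgHom R (CyclotomicRel q v n)
        (RingQuot.mkAlgHom R (AffineRel q n) z)) (groupGen_relation (R := R) h)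
    rintro x y (⟨i, h₁, h₂⟩ | ⟨i, j, hi₁, hi₂, hj₁, hj₂, hij⟩ | ⟨h⟩ | ⟨i, h₁, h₂⟩ |
      ⟨i, h₁, h₂⟩ | ⟨h⟩)
    · have := rel (BraidRelator.braid i h₁ h₂ _ _ rfl rfl)
      simp only [map_mul] at this
      simp only [map_mul, freeSigma, FreeAlgebra.lift_ι_apply]
      exact this
    · have := rel (BraidRelator.comm i j hi₁ hi₂ hj₁ hj₂ hij _ _ rfl rfl)
      simp only [map_mul] at this
      simp only [map_mul, freeSigma, FreeAlgebra.lift_ι_apply]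
      exact this
    · have := rel (BraidRelator.tau_braid h _ _ rfl rfl)
      simp only [map_mul] at this
      simp only [map_mul, freeSigma, freeTau, FreeAlgebra.lift_ι_apply]
      exact this
    · have := rel (BraidRelator.tau_comm i h₁ h₂ _ _ rfl rfl)
      simp only [map_mul] at this
      simp only [map_mul, freeSigma, freeTau, FreeAlgebra.lift_ι_apply]
      exact this
    · have := congrArg (RingQuot.mkAlgHom R (CyclotomicRel q v n))
        (RingQuot.mkAlgHom_rel R (AffineRel.quadratic (q := q) i h₁ h₂))
      simp only [map_pow, map_add, map_smul, map_one] at this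
      simp only [map_pow, map_add, map_smul, map_one, freeSigma, FreeAlgebra.lift_ι_apply]
      exact this
    · have := RingQuot.mkAlgHom_rel R (CyclotomicRel.cyclotomic (q := q) (v := v) h)
      rw [map_zero, map_list_prod, List.map_ofFn] at this
      rw [map_zero, map_list_prod, List.map_ofFn, ← this]
      congr 2
      funext a
      simp only [Function.comp, map_sub, AlgHom.commutes, freeTau, FreeAlgebra.lift_ι_apply]
      rfl⟩

/-- The algebra map from the affine Hecke algebra to the presented algebra. -/
noncomputable def ofAffine (q : Rˣ) (v : Fin m → R) (n : ℕ) (hv : ∀ a, IsUnit (v a)) :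
    AffineHecke q n →ₐ[R] CyclotomicHecke q v n :=
  RingQuot.liftAlgHom R ⟨MonoidAlgebra.lift R _ (BraidGroupB n)
    ((Units.coeHom _).comp (PresentedGroup.toGroup (unitGen_relator q v hv))), by
    rintro x y ⟨i, h₁, h₂⟩
    simp only [map_pow, map_add, map_smul, map_one, groupGen, MonoidAlgebra.lift_of,
      MonoidHom.comp_apply, PresentedGroup.toGroup.of]
    exact sigmaElt_sq q v i h₁ h₂⟩

theorem ofAffine_gen (q : Rˣ) (v : Fin m → R) {n : ℕ} (hv : ∀ a, IsUnit (v a)) (g : Gen n) :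
    ofAffine q v n hv (affineGen q g) =
      RingQuot.mkAlgHom R (Rel q v n) (FreeAlgebra.ι R g) := by
  rw [← unitGen_val q v hv]
  simp only [ofAffine, affineGen, groupGen, RingQuot.liftAlgHom_mkAlgHom_apply,
    MonoidAlgebra.lift_of, MonoidHom.comp_apply, PresentedGroup.toGroup.of]
  rfl

/-- The algebra map from the quotient of the group algebra to the presented algebra. -/
noncomputable def ofGroupQuotient (q : Rˣ) (v : Fin m → R) (n : ℕ) (hv : ∀ a, IsUnit (v a)) :
    GroupQuotient q v n →ₐ[R] CyclotomicHecke q v n :=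
  RingQuot.liftAlgHom R ⟨ofAffine q v n hv, by
    rintro x y ⟨h⟩
    rw [map_zero, map_list_prod, List.map_ofFn, ← cyclotomic_eq q v h]
    congr 2
    funext a
    simp only [Function.comp, map_sub, AlgHom.commutes, ofAffine_gen]
    rfl⟩

theorem toGroupQuotient_gen (q : Rˣ) (v : Fin m → R) {n : ℕ} (g : Gen n) :
    toGroupQuotient q v n (RingQuot.mkAlgHom R (Rel q v n) (FreeAlgebra.ι R g)) =
      quotientGen q v g := by
  simp only [toGroupQuotient, RingQuot.liftAlgHom_mkAlgHom_apply, FreeAlgebra.lift_ι_apply]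

theorem ofGroupQuotient_gen (q : Rˣ) (v : Fin m → R) {n : ℕ} (hv : ∀ a, IsUnit (v a))
    (g : Gen n) :
    ofGroupQuotient q v n hv (quotientGen q v g) =
      RingQuot.mkAlgHom R (Rel q v n) (FreeAlgebra.ι R g) := by
  simp only [ofGroupQuotient, quotientGen, RingQuot.liftAlgHom_mkAlgHom_apply, ofAffine_gen]

/-- If all `v_a` are invertible, the algebra given by generators and relations is the cyclotomic
quotient of the affine Hecke algebra, with the same generators. -/
theorem exists_equiv_groupQuotient (q : Rˣ) (v : Fin m → R) (n : ℕ) (hv : ∀ a, IsUnit (v a)) :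
    ∃ e : CyclotomicHecke q v n ≃ₐ[R] GroupQuotient q v n,
      (∀ h : 1 ≤ n, e (tau q v h) = quotientGen q v (Gen.tau h)) ∧
      (∀ (i : ℕ) (h₁ : 1 ≤ i) (h₂ : i < n),
        e (sigma q v i h₁ h₂ : CyclotomicHecke q v n) = quotientGen q v (Gen.sigma i h₁ h₂)) := by
  refine ⟨AlgEquiv.ofAlgHom (toGroupQuotient q v n) (ofGroupQuotient q v n hv) ?_ ?_,
    fun h => toGroupQuotient_gen q v _, fun i h₁ h₂ => toGroupQuotient_gen q v _⟩
  · apply RingQuot.ringQuot_ext'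
    apply RingQuot.ringQuot_ext'
    refine MonoidAlgebra.algHom_ext' ?_ (Subsingleton.elim _ _)
    have hom : ∀ f g : BraidGroupB n →* GroupQuotient q v n,
        (∀ x, f (PresentedGroup.of x) = g (PresentedGroup.of x)) → f = g := by
      intro f g hfg
      have : f.toHomUnits = g.toHomUnits := by
        apply PresentedGroup.ext
        intro x
        exact Units.ext (hfg x)
      ext x
      exact congrArg Units.val (DFunLike.congr_fun this x)
    apply hom
    intro g
    exact (congrArg (toGroupQuotient q v n) (ofGroupQuotient_gen q v hv g)).trans
      (toGroupQuotient_gen q v g)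
  · apply RingQuot.ringQuot_ext'
    apply FreeAlgebra.hom_ext
    funext g
    exact (congrArg (ofGroupQuotient q v n hv) (toGroupQuotient_gen q v g)).trans
      (ofGroupQuotient_gen q v hv g)

end GroupQuotient

end CyclotomicHecke

namespace CyclotomicHecke

/-! Induction on `n`: every element of `H(m,1,n+1)` expands uniquely along `R_{n+1}` with
coefficients in `H(m,1,n)` on the right. Spanning is a matter of rewriting; for independence a
module of the right size is built by hand.

Let `f = (X - v_1) ⋯ (X - v_m)` and let `M` be the sum of `n + 1` copies of `R[X]/(f) ⊗ H(m,1,n)`,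
the vector `e_j(p ⊗ c)` standing for the word `σ_j⁻¹ ⋯ σ_1⁻¹ p(τ) σ_1 ⋯ σ_n c`. Left multiplication
of such words by `τ` and `σ_i` yields formulas that make sense in `M`; they are taken as definitions
of operators `T` and `S i`. Once these satisfy the defining relations, `M` is an `H(m,1,n+1)`-module
(`indRep`), and replacing vectors by words is an equivariant map `indMap` to `H(m,1,n+1)`. Its image
is a left ideal containing `1`, the word of `e_n(1 ⊗ 1)`, so it is onto. It is injective because `z
↦ z · e_n(1 ⊗ 1)` takes each word back to its vector. Since `f` is monic, the powers of `X` together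
with the normal words of rank `n` give a basis of `M`.

The work lies in the relations that involve `T`. With `h = q - q⁻¹`, `x = X ⊗ 1`, `y = 1 ⊗ τ`, `w_j
= σ_j⁻¹ ⋯ σ_1⁻¹` taken in the second factor and `E (p ⊗ c) = 1 ⊗ p(τ) c`, one has `T e_{j+1}(b) =
e_{j+1}(y b) + h e_0(x w_j (E b - b))`. The type B braid relation (`T_braid`) rests on `σ_1 τ σ_1`
commuting with `τ` in rank `n`, and `f(T) = 0` (`aeval_T_eq_zero`) on the divisibility of `b - E b`
by `x - y`. -/

/-- The relations of the affine Hecke algebra, for elements `t` and `s 1, …, s (n - 1)` of an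
algebra. -/
structure HeckeSystem {R H : Type*} [CommRing R] [Ring H] [Algebra R H] (h : R) (n : ℕ) (t : H)
    (s : ℕ → H) : Prop where
  braid : ∀ i, 1 ≤ i → i + 1 < n → s i * s (i + 1) * s i = s (i + 1) * s i * s (i + 1)
  comm : ∀ i j, 1 ≤ i → i + 1 < j → j < n → s i * s j = s j * s i
  tau_braid : 1 < n → t * s 1 * t * s 1 = s 1 * t * s 1 * t
  tau_comm : ∀ i, 1 < i → i < n → t * s i = s i * t
  quadratic : ∀ i, 1 ≤ i → i < n → s i * s i = h • s i + 1

/-! ### Words `s_j⁻¹ ⋯ s_1⁻¹` and `s_1 ⋯ s_j`, and moving generators across them. -/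

section Products

variable {R H : Type*} [CommRing R] [Ring H] [Algebra R H]

/-- `s_j⁻¹ ⋯ s_1⁻¹`, where `s_i⁻¹ = s_i - h`. -/
def descProd (h : R) (s : ℕ → H) : ℕ → H
  | 0 => 1
  | j + 1 => (s (j + 1) - h • 1) * descProd h s j

/-- `s_1 ⋯ s_j`. -/
def ascProd (s : ℕ → H) : ℕ → H
  | 0 => 1
  | j + 1 => ascProd s j * s (j + 1)

/-- Isolates the factor of index 1, the only one that need not commute with `t` in a Hecke system.
-/
theorem descProd_succ' (h : R) (s : ℕ → H) (j : ℕ) :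
    descProd h s (j + 1) = descProd h (fun i => s (i + 1)) j * (s 1 - h • 1) := by
  induction j with
  | zero => simp [descProd]
  | succ j ih => rw [descProd, ih, descProd, mul_assoc]

theorem ascProd_succ' (s : ℕ → H) (j : ℕ) :
    ascProd s (j + 1) = s 1 * ascProd (fun i => s (i + 1)) j := by
  induction j with
  | zero => simp [ascProd]
  | succ j ih => rw [ascProd, ih, ascProd, mul_assoc]

theorem map_descProd {H' : Type*} [Ring H'] [Algebra R H'] (φ : H →ₐ[R] H') (h : R) (s : ℕ → H)
    (j : ℕ) : φ (descProd h s j) = descProd h (fun i => φ (s i)) j := by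
  induction j with
  | zero => simp [descProd]
  | succ j ih => simp [descProd, ih]

theorem map_ascProd {H' : Type*} [Ring H'] [Algebra R H'] (φ : H →ₐ[R] H') (s : ℕ → H)
    (j : ℕ) : φ (ascProd s j) = ascProd (fun i => φ (s i)) j := by
  induction j with
  | zero => simp [ascProd]
  | succ j ih => simp [ascProd, ih]

theorem descProd_congr (h : R) {s s' : ℕ → H} (j : ℕ) (e : ∀ i, 1 ≤ i → i ≤ j → s i = s' i) :
    descProd h s j = descProd h s' j := by
  induction j with
  | zero => rfl
  | succ j ih =>
    rw [descProd, descProd, ih fun i h₁ h₂ => e i h₁ (by omega), e (j + 1) (by omega) le_rfl]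

theorem ascProd_congr {s s' : ℕ → H} (j : ℕ) (e : ∀ i, 1 ≤ i → i ≤ j → s i = s' i) :
    ascProd s j = ascProd s' j := by
  induction j with
  | zero => rfl
  | succ j ih =>
    rw [ascProd, ascProd, ih fun i h₁ h₂ => e i h₁ (by omega), e (j + 1) (by omega) le_rfl]

theorem commute_descProd {z : H} (h : R) {s : ℕ → H} (j : ℕ)
    (e : ∀ i, 1 ≤ i → i ≤ j → Commute z (s i)) : Commute z (descProd h s j) := by
  induction j with
  | zero => exact Commute.one_right z
  | succ j ih =>
    refine Commute.mul_right (Commute.sub_right (e _ (by omega) le_rfl) ?_)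
      (ih fun i h₁ h₂ => e i h₁ (by omega))
    exact (Commute.one_right z).smul_right h

theorem commute_ascProd {z : H} {s : ℕ → H} (j : ℕ)
    (e : ∀ i, 1 ≤ i → i ≤ j → Commute z (s i)) : Commute z (ascProd s j) := by
  induction j with
  | zero => exact Commute.one_right z
  | succ j ih =>
    exact Commute.mul_right (ih fun i h₁ h₂ => e i h₁ (by omega)) (e _ (by omega) le_rfl)

theorem commute_aeval {z t : H} (c : Commute z t) (p : Polynomial R) :
    Commute z (Polynomial.aeval t p) := by
  induction p using Polynomial.induction_on' with
  | add p p' hp hp' => rw [map_add]; exact hp.add_right hp'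
  | monomial k r =>
    rw [Polynomial.aeval_monomial]
    exact (Algebra.commute_algebraMap_right r z).mul_right (c.pow_right k)

namespace HeckeSystem

variable {h : R} {n : ℕ} {t : H} {s : ℕ → H}

theorem mono (hs : HeckeSystem h (n + 1) t s) : HeckeSystem h n t s where
  braid i h₁ h₂ := hs.braid i h₁ (by omega)
  comm i j h₁ h₂ h₃ := hs.comm i j h₁ h₂ (by omega)
  tau_braid h₁ := hs.tau_braid (by omega)
  tau_comm i h₁ h₂ := hs.tau_comm i h₁ (by omega)
  quadratic i h₁ h₂ := hs.quadratic i h₁ (by omega)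

theorem map (hs : HeckeSystem h n t s) {H' : Type*} [Ring H'] [Algebra R H'] (φ : H →ₐ[R] H') :
    HeckeSystem h n (φ t) (fun i => φ (s i)) where
  braid i h₁ h₂ := by simpa using congrArg φ (hs.braid i h₁ h₂)
  comm i j h₁ h₂ h₃ := by simpa using congrArg φ (hs.comm i j h₁ h₂ h₃)
  tau_braid h₁ := by simpa using congrArg φ (hs.tau_braid h₁)
  tau_comm i h₁ h₂ := by simpa using congrArg φ (hs.tau_comm i h₁ h₂)
  quadratic i h₁ h₂ := by simpa using congrArg φ (hs.quadratic i h₁ h₂)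

theorem mul_inv (hs : HeckeSystem h n t s) {i : ℕ} (h₁ : 1 ≤ i) (h₂ : i < n) :
    s i * (s i - h • 1) = 1 := by
  rw [mul_sub, hs.quadratic i h₁ h₂, mul_smul_comm, mul_one, add_sub_cancel_left]

theorem inv_mul (hs : HeckeSystem h n t s) {i : ℕ} (h₁ : 1 ≤ i) (h₂ : i < n) :
    (s i - h • 1) * s i = 1 := by
  rw [sub_mul, hs.quadratic i h₁ h₂, smul_mul_assoc, one_mul, add_sub_cancel_left]

theorem mul_descProd_succ (hs : HeckeSystem h n t s) {j : ℕ} (h₂ : j + 1 < n) :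
    s (j + 1) * descProd h s (j + 1) = descProd h s j := by
  rw [descProd, ← mul_assoc, hs.mul_inv (by omega) h₂, one_mul]

theorem mul_descProd (s : ℕ → H) (j : ℕ) :
    s (j + 1) * descProd h s j = descProd h s (j + 1) + h • descProd h s j := by
  rw [descProd, sub_mul, smul_mul_assoc, one_mul, sub_add_cancel]

theorem mul_descProd_of_gt (hs : HeckeSystem h n t s) {i j : ℕ} (h₁ : j + 1 < i) (h₂ : i < n) :
    s i * descProd h s j = descProd h s j * s i :=
  commute_descProd h j fun k hk hk' => (hs.comm k i hk (by omega) h₂).symm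

/-- The braid relation with `s i` and `s (i + 1)` cancelled from suitable sides; it lets `s i` cross
two adjacent inverse factors, its index rising by one. -/
theorem braid_inv (hs : HeckeSystem h n t s) {i : ℕ} (h₁ : 1 ≤ i) (h₂ : i + 1 < n) :
    s i * ((s (i + 1) - h • 1) * (s i - h • 1)) =
      (s (i + 1) - h • 1) * (s i - h • 1) * s (i + 1) := by
  have a := hs.braid i h₁ h₂
  have l := hs.inv_mul (i := i + 1) (by omega) h₂
  have l' := hs.inv_mul h₁ (by omega : i < n)
  have r := hs.mul_inv (i := i + 1) (by omega) h₂
  have r' := hs.mul_inv h₁ (by omega : i < n)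
  set b := s (i + 1) - h • 1
  set c := s i - h • 1
  have key : b * c * (s (i + 1) * s i * s (i + 1)) = s i := by
    rw [← a, mul_assoc (s i), mul_assoc b, ← mul_assoc c, l', one_mul, ← mul_assoc, l, one_mul]
  calc s i * (b * c) = b * c * (s (i + 1) * s i * s (i + 1)) * (b * c) := by rw [key]
    _ = b * c * s (i + 1) * (s i * (s (i + 1) * b) * c) := by simp only [mul_assoc]
    _ = b * c * s (i + 1) := by rw [r, mul_one, r', mul_one]

/-- Factors of index above `i + 1` commute with `s i`; `braid_inv` carries it across those of index
`i + 1` and `i` as `s (i + 1)`, which commutes with all the remaining ones. -/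
theorem mul_descProd_of_lt (hs : HeckeSystem h n t s) {i j : ℕ} (h₁ : 1 ≤ i) (h₂ : i < j)
    (h₃ : j < n) : s i * descProd h s j = descProd h s j * s (i + 1) := by
  induction j, h₂ using Nat.le_induction with
  | base =>
    obtain ⟨i, rfl⟩ : ∃ k, i = k + 1 := ⟨i - 1, by omega⟩
    have := hs.mul_descProd_of_gt (i := i + 1 + 1) (j := i) (by omega) h₃
    rw [Nat.succ_eq_add_one, descProd, descProd, ← mul_assoc _ _ (descProd h s i), ← mul_assoc,
      hs.braid_inv h₁ h₃, mul_assoc, this, ← mul_assoc]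
  | succ j hj ih =>
    rw [descProd, mul_assoc, ← ih (by omega), ← mul_assoc, ← mul_assoc, mul_sub,
      sub_mul (s (j + 1)), hs.comm i (j + 1) h₁ (by omega) h₃, mul_smul_comm, smul_mul_assoc,
      mul_one, one_mul]

theorem mul_ascProd_of_lt (hs : HeckeSystem h n t s) {i j : ℕ} (h₁ : 1 ≤ i) (h₂ : i < j)
    (h₃ : j < n) : s (i + 1) * ascProd s j = ascProd s j * s i := by
  induction j, h₂ using Nat.le_induction with
  | base =>
    obtain ⟨i, rfl⟩ : ∃ k, i = k + 1 := ⟨i - 1, by omega⟩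
    have : Commute (s (i + 1 + 1)) (ascProd s i) :=
      commute_ascProd i fun k hk hk' => (hs.comm k (i + 1 + 1) hk (by omega) h₃).symm
    rw [Nat.succ_eq_add_one, ascProd, ascProd, ← mul_assoc, ← mul_assoc, this.eq,
      mul_assoc, mul_assoc, ← mul_assoc (s (i + 1 + 1)), ← hs.braid (i + 1) h₁ h₃]
    simp only [mul_assoc]
  | succ j hj ih =>
    rw [ascProd, ← mul_assoc, ih (by omega), mul_assoc, mul_assoc,
      hs.comm i (j + 1) h₁ (by omega) h₃]

end HeckeSystem

/-- Elements `x`, `y`, `s i` of an algebra and an operator `E` that behave like `X ⊗ 1`, `1 ⊗ t`,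
`1 ⊗ s i` and `p ⊗ c ↦ 1 ⊗ p(t) c` on `R[X] ⊗ H`, where `t` and the `s i` form a Hecke system. -/
structure InducedCoeff {B : Type*} [Ring B] [Algebra R B] (h : R) (n : ℕ) (x y : B) (s : ℕ → B)
    (E : B →ₗ[R] B) : Prop where
  sys : HeckeSystem h n y s
  xy : x * y = y * x
  xs : ∀ i, 1 ≤ i → i < n → x * s i = s i * x
  E_x : 1 ≤ n → ∀ b, E (x * b) = y * E b
  E_y : 1 ≤ n → ∀ b, E (y * b) = y * E b
  E_E : 1 ≤ n → ∀ b, E (E b) = E b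
  E_s_E : 1 < n → ∀ b, E (s 1 * E b) = s 1 * E b
  E_s : ∀ i, 1 < i → i < n → ∀ b, E (s i * b) = s i * E b
  E_sys : 1 < n → ∀ b, E (s 1 * (y * (s 1 * b))) = s 1 * (y * (s 1 * E b))

/-- Operators `T` and `S i` on a module spanned by elements `e j b`, for `j ≤ n` and `b` in an
algebra with a Hecke system of rank `n`. The element `e j b` stands for
`s_j⁻¹ ⋯ s_1⁻¹ x s_1 ⋯ s_n b`. -/
structure InducedModel {B M : Type*} [Ring B] [Algebra R B] [AddCommGroup M] [Module R M]
    (h : R) (n : ℕ) (x y : B) (s : ℕ → B) (E : B →ₗ[R] B) (e : ℕ → B →ₗ[R] M)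
    (T : Module.End R M) (S : ℕ → Module.End R M) : Prop extends InducedCoeff h n x y s E where
  S_lt : ∀ i j b, 1 ≤ i → i < j → j ≤ n → S i (e j b) = e j (s i * b)
  S_eq : ∀ j b, j < n → S (j + 1) (e (j + 1) b) = e j b
  S_succ : ∀ j b, j < n → S (j + 1) (e j b) = e (j + 1) b + h • e j b
  S_gt : ∀ i j b, j < i → i < n → S (i + 1) (e j b) = e j (s i * b)
  T_zero : ∀ b, T (e 0 b) = e 0 (x * b)
  T_succ : ∀ j b, j < n →
    T (e (j + 1) b) = e (j + 1) (y * b) + h • e 0 (x * (descProd h s j * (E b - b)))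
  ext : ∀ f g : Module.End R M, (∀ j b, j ≤ n → f (e j b) = g (e j b)) → f = g

end Products
end CyclotomicHecke

/-! ### The operators of an induced model satisfy the relations of rank `n + 1`. -/

namespace CyclotomicHecke
namespace InducedModel

variable {R B M : Type*} [CommRing R] [Ring B] [Algebra R B] [AddCommGroup M] [Module R M]
  {h : R} {n : ℕ} {x y : B} {s : ℕ → B} {E : B →ₗ[R] B} {e : ℕ → B →ₗ[R] M}
  {T : Module.End R M} {S : ℕ → Module.End R M}

theorem S_quadratic (H : InducedModel h n x y s E e T S) (i : ℕ) (h₁ : 1 ≤ i) (h₂ : i < n + 1) :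
    S i * S i = h • S i + 1 := by
  refine H.ext _ _ fun j b hj => ?_
  obtain ⟨i, rfl⟩ : ∃ k, i = k + 1 := ⟨i - 1, by omega⟩
  simp only [Module.End.mul_apply, LinearMap.add_apply, LinearMap.smul_apply, Module.End.one_apply]
  rcases lt_trichotomy (i + 1) j with hij | rfl | hij
  · rw [H.S_lt _ _ _ h₁ hij hj, H.S_lt _ _ _ h₁ hij hj, ← mul_assoc,
      H.sys.quadratic _ h₁ (by omega), add_mul, map_add, one_mul, smul_mul_assoc, map_smul]
  · rw [H.S_eq _ _ (by omega), H.S_succ _ _ (by omega), add_comm]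
  · rcases (show j = i ∨ j < i by omega) with rfl | hij
    · rw [H.S_succ _ _ (by omega), map_add, map_smul, H.S_eq _ _ (by omega),
        H.S_succ _ _ (by omega), add_comm]
    · rw [H.S_gt _ _ _ hij (by omega), H.S_gt _ _ _ hij (by omega), ← mul_assoc,
      H.sys.quadratic _ (by omega) (by omega), add_mul, map_add, one_mul, smul_mul_assoc, map_smul]

/-- The two operators mix only `e (i - 1)`, `e i` and `e (i + 1)`. On any other `e j` both act by
generators of `B`, and the braid relation there applies; on the three mixed ones it is a direct
computation. -/
theorem S_braid (H : InducedModel h n x y s E e T S) (i : ℕ) (h₁ : 1 ≤ i) (h₂ : i + 1 < n + 1) :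
    S i * S (i + 1) * S i = S (i + 1) * S i * S (i + 1) := by
  refine H.ext _ _ fun j b hj => ?_
  obtain ⟨i, rfl⟩ : ∃ k, i = k + 1 := ⟨i - 1, by omega⟩
  simp only [Module.End.mul_apply]
  have hi : i + 1 < n := by omega
  rcases (show i + 2 < j ∨ j = i + 2 ∨ j = i + 1 ∨ j = i ∨ j < i by omega) with
    hij | rfl | rfl | rfl | hij
  · simp only [H.S_lt (i + 1) j _ (by omega) (by omega) hj,
      H.S_lt (i + 1 + 1) j _ (by omega) (by omega) hj, ← mul_assoc]
    rw [H.sys.braid _ (by omega) (by omega)]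
  · simp only [H.S_lt (i + 1) (i + 2) _ (by omega) (by omega) hj, H.S_eq (i + 1) _ hi,
      H.S_eq i _ (by omega), H.S_gt (i + 1) i _ (by omega) hi]
  · simp only [H.S_lt (i + 1) (i + 2) _ (by omega) (by omega) hi,
      H.S_eq i _ (by omega), H.S_eq (i + 1) _ hi, H.S_gt (i + 1) i _ (by omega) hi,
      H.S_succ (i + 1) _ hi,
      H.S_succ i _ (by omega), map_add, map_smul]
  · simp only [H.S_lt (j + 1) (j + 2) _ (by omega) (by omega) hi,
      H.S_eq j _ (by omega), H.S_gt (j + 1) j _ (by omega) hi, H.S_succ (j + 1) _ hi,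
      H.S_succ j _ (by omega), map_add, map_smul]
    rw [← mul_assoc (s (j + 1)), H.sys.quadratic (j + 1) (by omega) hi]
    simp only [add_mul, one_mul, smul_mul_assoc, map_add, map_smul]
    module
  · simp only [H.S_gt i j _ (by omega) (by omega), H.S_gt (i + 1) j _ (by omega) (by omega),
      ← mul_assoc]
    rw [H.sys.braid _ (by omega) (by omega)]

theorem S_comm (H : InducedModel h n x y s E e T S) (i k : ℕ) (h₁ : 1 ≤ i) (h₂ : i + 1 < k)
    (h₃ : k < n + 1) : S i * S k = S k * S i := by
  refine H.ext _ _ fun j b hj => ?_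
  obtain ⟨i, rfl⟩ : ∃ k, i = k + 1 := ⟨i - 1, by omega⟩
  obtain ⟨k, rfl⟩ : ∃ l, k = l + 1 := ⟨k - 1, by omega⟩
  simp only [Module.End.mul_apply]
  rcases (show k + 1 < j ∨ j = k + 1 ∨ j = k ∨ (i + 1 < j ∧ j < k) ∨ j = i + 1 ∨ j = i ∨ j < i
    by omega) with hij | rfl | rfl | ⟨hij, hjk⟩ | rfl | rfl | hij
  · simp only [H.S_lt (i + 1) j _ (by omega) (by omega) hj,
      H.S_lt (k + 1) j _ (by omega) (by omega) hj, ← mul_assoc]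
    rw [H.sys.comm _ _ (by omega) (by omega) (by omega)]
  · simp only [H.S_lt (i + 1) (k + 1) _ (by omega) (by omega) hj, H.S_eq k _ (by omega),
      H.S_lt (i + 1) k _ (by omega) (by omega) (by omega)]
  · simp only [H.S_lt (i + 1) (j + 1) _ (by omega) (by omega) (show j + 1 ≤ n by omega),
      H.S_succ j _ (by omega), H.S_lt (i + 1) j _ (by omega) (by omega) hj, map_add, map_smul]
  · simp only [H.S_lt (i + 1) j _ (by omega) (by omega) hj, H.S_gt k j _ hjk (by omega),
      ← mul_assoc]
    rw [H.sys.comm _ _ (by omega) (by omega) (by omega)]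
  · simp only [H.S_gt k (i + 1) _ (by omega) (by omega), H.S_eq i _ (by omega),
      H.S_gt k i _ (by omega) (by omega)]
  · simp only [H.S_gt k (j + 1) _ (by omega) (by omega), H.S_succ j _ (by omega),
      H.S_gt k j _ (by omega) (by omega), map_add, map_smul]
  · simp only [H.S_gt i j _ (by omega) (by omega), H.S_gt k j _ (by omega) (by omega),
      ← mul_assoc]
    rw [H.sys.comm _ _ (by omega) (by omega) (by omega)]

/-- The correction term in `T` is compatible because `s (i - 1)` multiplies `descProd h s j` by the
same four rules by which `S i` acts on `e (j + 1)`. -/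
theorem T_comm_S (H : InducedModel h n x y s E e T S) (i : ℕ) (h₁ : 1 < i) (h₂ : i < n + 1) :
    T * S i = S i * T := by
  refine H.ext _ _ fun j b hj => ?_
  obtain ⟨i, rfl⟩ : ∃ k, i = k + 1 := ⟨i - 1, by omega⟩
  simp only [Module.End.mul_apply]
  have gz := fun b => H.S_gt i 0 b (by omega) (by omega)
  have xs : ∀ b, s i * (x * b) = x * (s i * b) := fun b => by
    rw [← mul_assoc, ← H.xs i (by omega) (by omega), mul_assoc]
  rcases Nat.eq_zero_or_pos j with rfl | hj0
  · simp only [gz, H.T_zero, xs]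
  obtain ⟨j, rfl⟩ : ∃ k, j = k + 1 := ⟨j - 1, by omega⟩
  have hT := fun b => H.T_succ j b (by omega)
  rcases (show i < j ∨ i = j ∨ i = j + 1 ∨ j + 1 < i by omega) with hij | rfl | rfl | hij
  · have a := H.sys.mul_descProd_of_lt (i := i) (j := j) (by omega) hij (by omega)
    have c := H.sys.tau_comm (i + 1) (by omega) (by omega)
    have lt := fun b => H.S_lt (i + 1) (j + 1) b (by omega) (by omega) hj
    simp only [hT, lt, gz, map_add, map_smul, xs, H.E_s (i + 1) (by omega) (by omega)]
    rw [← mul_assoc, c, ← mul_assoc (s i), a, ← mul_sub]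
    simp only [mul_assoc]
  · obtain ⟨i, rfl⟩ : ∃ k, i = k + 1 := ⟨i - 1, by omega⟩
    have a := H.sys.mul_descProd_succ (j := i) (by omega)
    have sq := fun b => H.S_eq (i + 1) b (by omega)
    simp only [hT, sq, gz, map_add, map_smul, xs, H.T_succ i _ (by omega)]
    rw [← mul_assoc (s (i + 1)), a]
  · have a := HeckeSystem.mul_descProd (h := h) s j
    have sq := fun b => H.S_succ (j + 1) b (by omega)
    simp only [hT, sq, gz, map_add, map_smul, xs, H.T_succ (j + 1) _ (by omega)]
    rw [← mul_assoc (s (j + 1)), a]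
    simp only [add_mul, smul_mul_assoc, mul_add, mul_smul_comm, map_add, map_smul]
    module
  · have a := H.sys.mul_descProd_of_gt (i := i) (j := j) (by omega) (by omega)
    have c := H.sys.tau_comm i (by omega) (by omega)
    have gt := fun b => H.S_gt i (j + 1) b hij (by omega)
    simp only [hT, gt, gz, map_add, map_smul, xs, H.E_s i (by omega) (by omega)]
    rw [← mul_assoc, c, ← mul_assoc (s i) (descProd h s j), a, ← mul_sub]
    simp only [mul_assoc]


/-- On `e 0` and `e 1` this is a computation with `x`, `y` and `E` alone. On `e j` with `j ≥ 2` the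
operator `S 1` acts by `s 1`, and the relation comes from the type B relation in `B` together with
`E_sys`. -/
theorem T_braid (H : InducedModel h n x y s E e T S) (hn : 1 < n + 1) :
    T * S 1 * T * S 1 = S 1 * T * S 1 * T := by
  have hn1 : 1 ≤ n := by omega
  refine H.ext _ _ fun j b hj => ?_
  simp only [Module.End.mul_apply]
  have s0 := fun b => H.S_succ 0 b hn1
  have s1 := fun b => H.S_eq 0 b hn1
  have t1 := fun b => H.T_succ 0 b hn1
  have yx : ∀ b, y * (x * b) = x * (y * b) := fun b => by
    rw [← mul_assoc, ← H.xy, mul_assoc]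
  simp only [zero_add, descProd, one_mul] at s0 s1 t1
  rcases (show j = 0 ∨ j = 1 ∨ 2 ≤ j by omega) with rfl | rfl | hj2
  · simp only [s0, s1, t1, H.T_zero, map_add, map_smul, H.E_x hn1, H.E_E hn1, mul_sub,
      map_sub, yx]
    module
  · simp only [s0, s1, t1, H.T_zero, map_add, map_smul, H.E_x hn1, H.E_E hn1, mul_sub,
      map_sub, yx]
    module
  obtain ⟨j, rfl⟩ : ∃ k, j = k + 2 := ⟨j - 2, by omega⟩
  have t2 := fun b => H.T_succ (j + 1) b (by omega)
  have sl := fun b => H.S_lt 1 (j + 2) b le_rfl (by omega) hj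
  have quad := H.sys.quadratic 1 le_rfl (by omega)
  -- The word of length `j + 1` is split as a part with indices at least 2, across which both `y`
  -- and `E` pass, times `s_1⁻¹`.
  have yw : Commute y (descProd h (fun i => s (i + 1)) j) :=
    commute_descProd h j fun i h₁ h₂ => H.sys.tau_comm (i + 1) (by omega) (by omega)
  have yw' : ∀ b, y * (descProd h (fun i => s (i + 1)) j * b) =
      descProd h (fun i => s (i + 1)) j * (y * b) := fun b => by
    rw [← mul_assoc, yw.eq, mul_assoc]
  have ss : ∀ b, s 1 * (s 1 * b) = h • (s 1 * b) + b := fun b => by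
    rw [← mul_assoc, quad, add_mul, smul_mul_assoc, one_mul]
  have br : ∀ b, y * (s 1 * (y * (s 1 * b))) = s 1 * (y * (s 1 * (y * b))) := fun b => by
    simp only [← mul_assoc, H.sys.tau_braid (by omega)]
  have Esys := H.E_sys (by omega)
  have Esy : ∀ b, E (s 1 * (y * b)) =
      s 1 * (y * (s 1 * E (s 1 * b))) - h • (s 1 * (y * (s 1 * E b))) := fun b => by
    -- The argument is `s_1⁻¹ b`, so that the inner `s 1` of `E_sys` cancels.
    have := Esys (s 1 * b - h • b)
    simp only [mul_sub, ss, mul_smul_comm, add_sub_cancel_left, map_sub, map_smul] at this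
    exact this
  have hE : ∀ b, E (descProd h (fun i => s (i + 1)) j * b) =
      descProd h (fun i => s (i + 1)) j * E b := by
    have : ∀ k, k ≤ j → ∀ b, E (descProd h (fun i => s (i + 1)) k * b) =
        descProd h (fun i => s (i + 1)) k * E b := by
      intro k
      induction k with
      | zero => intro _ b; simp [descProd]
      | succ k ih =>
        intro hk b
        simp only [descProd, sub_mul, smul_mul_assoc, one_mul, mul_assoc, map_sub, map_smul,
          H.E_s (k + 1 + 1) (by omega) (by omega), ih (by omega)]
    exact this j le_rfl
  rw [descProd_succ'] at t2
  simp only [sl, t2, s0, s1, t1, H.T_zero, map_add, map_smul, H.E_x hn1, H.E_E hn1,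
    H.E_s_E (by omega), hE, mul_add, mul_sub, sub_mul, map_sub, yx, mul_assoc, smul_mul_assoc, one_mul, yw', Esys, Esy, ss, br,
    mul_smul_comm]
  module

theorem heckeSystem (H : InducedModel h n x y s E e T S) : HeckeSystem h (n + 1) T S where
  braid := H.S_braid
  comm := H.S_comm
  tau_braid := H.T_braid
  tau_comm := H.T_comm_S
  quadratic := H.S_quadratic

theorem pow_T_apply (H : InducedModel h n x y s E e T S) (k : ℕ) (b : B) :
    (T ^ k) (e 0 b) = e 0 (x ^ k * b) := by
  induction k with
  | zero => simp
  | succ k ih => rw [pow_succ', Module.End.mul_apply, ih, H.T_zero, pow_succ', mul_assoc]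

/-- On `e 0` the operator `T` is multiplication by `x`. On `e (j + 1)` the correction can be
absorbed: if `(x - y) d = b - E b`, adding a suitable `e 0` term built from `d` gives a vector on
which `T` acts as multiplication of both `b` and `d` by `y`. As `f` kills `x` and `y`, it kills the
new vector and the added term. -/
theorem aeval_T_eq_zero (H : InducedModel h n x y s E e T S) (f : Polynomial R)
    (fx : Polynomial.aeval x f = 0) (fy : 1 ≤ n → Polynomial.aeval y f = 0)
    (hd : 1 ≤ n → ∀ b, ∃ d, x * d - y * d = b - E b) : Polynomial.aeval T f = 0 := by
  have zero : ∀ b, Polynomial.aeval T f (e 0 b) = 0 := fun b => by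
    have : ∀ g : Polynomial R, Polynomial.aeval T g (e 0 b) = e 0 (Polynomial.aeval x g * b) := by
      intro g
      induction g using Polynomial.induction_on' with
      | add g g' hg hg' => simp only [map_add, LinearMap.add_apply, hg, hg', add_mul]
      | monomial k r =>
        simp only [Polynomial.aeval_monomial, ← Algebra.smul_def, LinearMap.smul_apply, H.pow_T_apply,
          smul_mul_assoc, map_smul]
    rw [this, fx, zero_mul, map_zero]
  refine H.ext _ _ fun j b hj => ?_
  rw [LinearMap.zero_apply]
  rcases Nat.eq_zero_or_pos j with rfl | hj0
  · exact zero b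
  obtain ⟨j, rfl⟩ : ∃ k, j = k + 1 := ⟨j - 1, by omega⟩
  have hn : 1 ≤ n := by omega
  obtain ⟨d, hd⟩ := hd hn b
  have xw : ∀ b, descProd h s j * (x * b) = x * (descProd h s j * b) := fun b => by
    have : Commute x (descProd h s j) :=
      commute_descProd h j fun i h₁ h₂ => H.xs i h₁ (by omega)
    rw [← mul_assoc, ← this.eq, mul_assoc]
  -- The corrected vector. The condition linking `b` and `d` is preserved when both are multiplied
  -- by `y`, hence the joint induction below.
  set u : B → B → M := fun b d => e (j + 1) b + h • e 0 (x * (descProd h s j * d)) with hu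
  have pow : ∀ k : ℕ, (T ^ k) (u b d) = u (y ^ k * b) (y ^ k * d) ∧
      x * (y ^ k * d) - y * (y ^ k * d) = y ^ k * b - E (y ^ k * b) := fun k => by
    induction k with
    | zero => simp [hd]
    | succ k ih =>
      obtain ⟨ih₁, ih₂⟩ := ih
      simp only [pow_succ', Module.End.mul_apply, ih₁, mul_assoc]
      generalize y ^ k * b = b' at *
      generalize y ^ k * d = d' at *
      constructor
      · simp only [hu, map_add, map_smul, H.T_succ j _ hj, H.T_zero]
        rw [add_assoc, ← smul_add, ← map_add, ← mul_add, ← xw, ← mul_add,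
          show E b' - b' + x * d' = y * d' by rw [sub_eq_iff_eq_add.mp ih₂]; abel]
      · rw [H.E_y hn, ← mul_sub y b', ← ih₂, mul_sub, ← mul_assoc, H.xy, mul_assoc]
  have main : ∀ g : Polynomial R, Polynomial.aeval T g (u b d) =
      u (Polynomial.aeval y g * b) (Polynomial.aeval y g * d) := by
    intro g
    induction g using Polynomial.induction_on' with
    | add g g' hg hg' =>
      simp only [map_add, LinearMap.add_apply, hg, hg', add_mul]
      simp only [hu, map_add, mul_add]
      module
    | monomial k r =>
      simp only [Polynomial.aeval_monomial, ← Algebra.smul_def, LinearMap.smul_apply, (pow k).1,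
        smul_mul_assoc]
      simp only [hu, map_smul, mul_smul_comm]
      module
  have := main f
  simpa [hu, fy hn, zero] using this

end InducedModel
end CyclotomicHecke

namespace CyclotomicHecke

/-! ### A concrete model on `B ^ (n + 1)`. -/

section Model

variable {R B M : Type*} [CommRing R] [Ring B] [Algebra R B] [AddCommGroup M] [Module R M]

/-- The linear map on `B ^ (n + 1)` given by `F j` on the `j`-th coordinate, `0 ≤ j ≤ n`. -/
def sumOp (n : ℕ) (F : ℕ → B →ₗ[R] M) : (Fin (n + 1) → B) →ₗ[R] M :=
  ∑ j : Fin (n + 1), F j ∘ₗ LinearMap.proj j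

/-- The `j`-th coordinate embedding of `B` into `B ^ (n + 1)`, for `j ≤ n`. -/
def coordVec (R : Type*) {B : Type*} [CommRing R] [Ring B] [Algebra R B] (n j : ℕ) :
    B →ₗ[R] (Fin (n + 1) → B) :=
  if hj : j < n + 1 then LinearMap.single R (fun _ => B) ⟨j, hj⟩ else 0

theorem coordVec_apply {n : ℕ} (j : Fin (n + 1)) (b : B) :
    coordVec R n j b = Pi.single j b := by
  rw [coordVec, dif_pos j.isLt]
  rfl

theorem sumOp_coordVec {n j : ℕ} (hj : j ≤ n) (F : ℕ → B →ₗ[R] M) (b : B) :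
    sumOp n F (coordVec R n j b) = F j b := by
  have := coordVec_apply (R := R) (⟨j, Nat.lt_succ_of_le hj⟩ : Fin (n + 1)) b
  rw [show coordVec R n j b = _ from this, sumOp, LinearMap.sum_apply,
    Finset.sum_eq_single ⟨j, Nat.lt_succ_of_le hj⟩]
  · simp
  · intro k _ hk
    simp [Pi.single_eq_of_ne hk]
  · simp

theorem coordVec_hom_ext {n : ℕ} {f g : (Fin (n + 1) → B) →ₗ[R] M}
    (H : ∀ j b, j ≤ n → f (coordVec R n j b) = g (coordVec R n j b)) : f = g :=
  LinearMap.pi_ext fun j b => by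
    have := H j b (Nat.le_of_lt_succ j.isLt)
    rwa [coordVec_apply] at this

/-- The action of `s i` on `B ^ (n + 1)`. -/
def sigmaOp (h : R) (n : ℕ) (s : ℕ → B) (i : ℕ) : Module.End R (Fin (n + 1) → B) :=
  sumOp n fun j =>
    if i < j then coordVec R n j ∘ₗ LinearMap.mulLeft R (s i)
    else if i = j then coordVec R n (j - 1)
    else if i = j + 1 then coordVec R n (j + 1) + h • coordVec R n j
    else coordVec R n j ∘ₗ LinearMap.mulLeft R (s (i - 1))

/-- The action of `t` on `B ^ (n + 1)`. -/
def tauOp (h : R) (n : ℕ) (x y : B) (s : ℕ → B) (E : B →ₗ[R] B) :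
    Module.End R (Fin (n + 1) → B) :=
  sumOp n fun j =>
    if j = 0 then coordVec R n 0 ∘ₗ LinearMap.mulLeft R x
    else coordVec R n j ∘ₗ LinearMap.mulLeft R y +
      h • (coordVec R n 0 ∘ₗ LinearMap.mulLeft R x ∘ₗ
        LinearMap.mulLeft R (descProd h s (j - 1)) ∘ₗ (E - LinearMap.id))

theorem InducedCoeff.model {h : R} {n : ℕ} {x y : B} {s : ℕ → B} {E : B →ₗ[R] B}
    (H : InducedCoeff h n x y s E) :
    InducedModel h n x y s E (coordVec R n) (tauOp h n x y s E) (sigmaOp h n s) where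
  toInducedCoeff := H
  S_lt i j b _ hij hj := by
    rw [sigmaOp, sumOp_coordVec hj]
    simp [hij]
  S_eq j b hj := by
    rw [sigmaOp, sumOp_coordVec hj]
    simp
  S_succ j b hj := by
    rw [sigmaOp, sumOp_coordVec hj.le]
    simp
  S_gt i j b hij hi := by
    rw [sigmaOp, sumOp_coordVec (by omega), if_neg (by omega), if_neg (by omega),
      if_neg (by omega)]
    simp
  T_zero b := by
    rw [tauOp, sumOp_coordVec (Nat.zero_le n)]
    simp
  T_succ j b hj := by
    rw [tauOp, sumOp_coordVec hj]
    simp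
  ext _ _ := coordVec_hom_ext

end Model

/-! ### Evaluation at `t` on `R[X]/(f) ⊗ H`. -/

section Quotient

variable {R H : Type*} [CommRing R] [Ring H] [Algebra R H]

/-- The algebra map from `R[X]/(f)` to a possibly noncommutative algebra, given by a root. -/
noncomputable def rootHom (f : Polynomial R) (t : H) (ht : Polynomial.aeval t f = 0) :
    AdjoinRoot f →ₐ[R] H :=
  Ideal.Quotient.liftₐ (Ideal.span {f}) (Polynomial.aeval t) fun a ha => by
    obtain ⟨b, rfl⟩ := Ideal.mem_span_singleton'.mp ha
    rw [map_mul, ht, mul_zero]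

theorem rootHom_mk (f : Polynomial R) (t : H) (ht : Polynomial.aeval t f = 0)
    (p : Polynomial R) : rootHom f t ht (AdjoinRoot.mk f p) = Polynomial.aeval t p :=
  rfl

theorem rootHom_root (f : Polynomial R) (t : H) (ht : Polynomial.aeval t f = 0) :
    rootHom f t ht (AdjoinRoot.root f) = t := by
  rw [AdjoinRoot.root, rootHom_mk, Polynomial.aeval_X]

theorem commute_rootHom {f : Polynomial R} {t z : H} (ht : Polynomial.aeval t f = 0)
    (hz : Commute z t) (p : AdjoinRoot f) : Commute z (rootHom f t ht p) := by
  induction p using AdjoinRoot.induction_on with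
  | ih p =>
    rw [rootHom_mk]
    exact commute_aeval hz p

open TensorProduct

/-- The operator `p ⊗ c ↦ 1 ⊗ p(t) c`. -/
noncomputable def evalOp (f : Polynomial R) (t : H) (ht : Polynomial.aeval t f = 0) :
    AdjoinRoot f ⊗[R] H →ₗ[R] AdjoinRoot f ⊗[R] H :=
  TensorProduct.lift
    ((LinearMap.mul R H).compr₂ Algebra.TensorProduct.includeRight.toLinearMap ∘ₗ
      (rootHom f t ht).toLinearMap)

theorem evalOp_tmul (f : Polynomial R) (t : H) (ht : Polynomial.aeval t f = 0)
    (p : AdjoinRoot f) (c : H) : evalOp f t ht (p ⊗ₜ c) = 1 ⊗ₜ (rootHom f t ht p * c) := by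
  simp [evalOp]

theorem evalOp_root_mul {f : Polynomial R} {t : H} (ht : Polynomial.aeval t f = 0)
    (b : AdjoinRoot f ⊗[R] H) :
    evalOp f t ht (AdjoinRoot.root f ⊗ₜ 1 * b) = 1 ⊗ₜ t * evalOp f t ht b := by
  induction b with
  | zero => simp
  | add b b' hb hb' => simp only [mul_add, map_add, hb, hb']
  | tmul p c =>
    simp only [Algebra.TensorProduct.tmul_mul_tmul, evalOp_tmul, map_mul, rootHom_root, one_mul,
      mul_assoc]

theorem evalOp_commute_mul {f : Polynomial R} {t z : H} (ht : Polynomial.aeval t f = 0)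
    (hz : Commute z t) (b : AdjoinRoot f ⊗[R] H) :
    evalOp f t ht (1 ⊗ₜ z * b) = 1 ⊗ₜ z * evalOp f t ht b := by
  induction b with
  | zero => simp
  | add b b' hb hb' => simp only [mul_add, map_add, hb, hb']
  | tmul p c =>
    simp only [Algebra.TensorProduct.tmul_mul_tmul, evalOp_tmul, one_mul, ← mul_assoc,
      (commute_rootHom ht hz p).eq]

theorem evalOp_mul_evalOp {f : Polynomial R} {t : H} (ht : Polynomial.aeval t f = 0) (z : H)
    (b : AdjoinRoot f ⊗[R] H) :
    evalOp f t ht (1 ⊗ₜ z * evalOp f t ht b) = 1 ⊗ₜ z * evalOp f t ht b := by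
  induction b with
  | zero => simp
  | add b b' hb hb' => simp only [mul_add, map_add, hb, hb']
  | tmul p c =>
    simp only [Algebra.TensorProduct.tmul_mul_tmul, evalOp_tmul, one_mul, map_one]

/-- The factor theorem: `evalOp` substitutes `y = 1 ⊗ t` for `x = X ⊗ 1`, so `b` and its image
differ by a multiple of `x - y`. The proof is by induction on the degree in `X`. -/
theorem exists_sub_evalOp_eq {f : Polynomial R} {t : H} (ht : Polynomial.aeval t f = 0)
    (b : AdjoinRoot f ⊗[R] H) :
    ∃ d, AdjoinRoot.root f ⊗ₜ 1 * d - 1 ⊗ₜ t * d = b - evalOp f t ht b := by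
  induction b with
  | zero => exact ⟨0, by simp⟩
  | add b b' hb hb' =>
    obtain ⟨d, hd⟩ := hb
    obtain ⟨d', hd'⟩ := hb'
    refine ⟨d + d', ?_⟩
    rw [mul_add, mul_add, map_add, add_sub_add_comm, hd, hd', add_sub_add_comm]
  | tmul p c =>
    induction p using AdjoinRoot.induction_on with
    | ih p =>
    induction p using Polynomial.induction_on with
    | C r =>
      refine ⟨0, ?_⟩
      have : AdjoinRoot.mk f (Polynomial.C r) = r • (1 : AdjoinRoot f) := by
        rw [Algebra.smul_def, mul_one]
        rfl
      rw [this, evalOp_tmul, map_smul, map_one, smul_mul_assoc, one_mul,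
        TensorProduct.smul_tmul, sub_self, mul_zero, mul_zero, sub_zero]
    | add p p' hp hp' =>
      obtain ⟨d, hd⟩ := hp
      obtain ⟨d', hd'⟩ := hp'
      refine ⟨d + d', ?_⟩
      rw [mul_add, mul_add, map_add, TensorProduct.add_tmul, map_add, add_sub_add_comm, hd, hd',
        add_sub_add_comm]
    | monomial k r ih =>
      obtain ⟨d, hd⟩ := ih
      rw [pow_succ', ← mul_assoc, mul_comm _ Polynomial.X, mul_assoc, map_mul,
        show AdjoinRoot.mk f Polynomial.X = AdjoinRoot.root f from rfl]
      generalize AdjoinRoot.mk f (Polynomial.C r * Polynomial.X ^ k) = p at hd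
      have e : (AdjoinRoot.root f * p) ⊗ₜ[R] c = AdjoinRoot.root f ⊗ₜ 1 * (p ⊗ₜ c) := by
        rw [Algebra.TensorProduct.tmul_mul_tmul, one_mul]
      have xy : AdjoinRoot.root f ⊗ₜ[R] (1 : H) * (1 ⊗ₜ t) = 1 ⊗ₜ t * AdjoinRoot.root f ⊗ₜ 1 := by
        simp
      -- From `x b - E (x b) = x (b - E b) + (x - y) E b`, as `E (x b) = y E b`.
      refine ⟨AdjoinRoot.root f ⊗ₜ 1 * d + evalOp f t ht (p ⊗ₜ c), ?_⟩
      have hb := sub_eq_iff_eq_add.mp hd.symm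
      rw [e, evalOp_root_mul]
      generalize evalOp f t ht (p ⊗ₜ c) = w at *
      rw [hb]
      simp only [mul_add, mul_sub, ← mul_assoc, xy]
      abel

/-- The operator `E` of the induced model, `0` if there is no `t`. -/
noncomputable def modelEval (f : Polynomial R) (n : ℕ) (t : H)
    (ht : 1 ≤ n → Polynomial.aeval t f = 0) :
    AdjoinRoot f ⊗[R] H →ₗ[R] AdjoinRoot f ⊗[R] H :=
  if hn : 1 ≤ n then evalOp f t (ht hn) else 0

theorem HeckeSystem.inducedCoeff {h : R} {n : ℕ} {t : H} {s : ℕ → H} (hs : HeckeSystem h n t s)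
    (f : Polynomial R) (ht : 1 ≤ n → Polynomial.aeval t f = 0) :
    InducedCoeff h n (AdjoinRoot.root f ⊗ₜ[R] (1 : H)) (1 ⊗ₜ t) (fun i => 1 ⊗ₜ s i)
      (modelEval f n t ht) where
  sys := hs.map (Algebra.TensorProduct.includeRight (R := R) (A := AdjoinRoot f))
  xy := by simp
  xs := by simp
  E_x hn b := by simp only [modelEval, dif_pos hn, evalOp_root_mul]
  E_y hn b := by simp only [modelEval, dif_pos hn, evalOp_commute_mul _ (Commute.refl t)]
  E_E hn b := by
    have := evalOp_mul_evalOp (ht hn) 1 b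
    rw [← Algebra.TensorProduct.one_def, one_mul] at this
    simpa only [modelEval, dif_pos hn] using this
  E_s_E hn b := by simp only [modelEval, dif_pos hn.le, evalOp_mul_evalOp]
  E_s i hi hn b := by
    have c : Commute (s i) t := (hs.tau_comm i hi hn).symm
    simp only [modelEval, dif_pos (show 1 ≤ n by omega), evalOp_commute_mul _ c]
  E_sys hn b := by
    -- The type B braid relation in commutator form; whatever commutes with `t` passes through
    -- evaluation at `t`.
    have c : Commute (s 1 * t * s 1) t := by
      have := hs.tau_braid hn
      simp only [Commute, SemiconjBy, mul_assoc] at this ⊢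
      exact this.symm
    simp only [modelEval, dif_pos hn.le, ← mul_assoc, Algebra.TensorProduct.tmul_mul_tmul,
      one_mul, evalOp_commute_mul _ c]

end Quotient

end CyclotomicHecke

namespace CyclotomicHecke

/-! ### Left multiplication of the words by generators, in an actual algebra. -/

section LeftMultiplication

variable {R H : Type*} [CommRing R] [Ring H] [Algebra R H] {h : R} {n : ℕ} {t : H} {s : ℕ → H}

/-- Here `p` plays the role of a polynomial in `t`. The index of `s i` rises by one across the
descending word and falls back across the ascending one. -/
theorem HeckeSystem.mul_left_lt (hs : HeckeSystem h (n + 1) t s) {i j : ℕ} {p : H} (h₁ : 1 ≤ i)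
    (hij : i < j) (hj : j ≤ n) (hp : ∀ i, 1 < i → i < n + 1 → Commute (s i) p) (c : H) :
    s i * (descProd h s j * p * ascProd s n * c) =
      descProd h s j * p * ascProd s n * (s i * c) := by
  have a := hs.mul_descProd_of_lt h₁ hij (by omega)
  have b := (hp (i + 1) (by omega) (by omega)).eq
  have d := hs.mul_ascProd_of_lt (j := n) h₁ (by omega) (by omega)
  simp only [← mul_assoc]
  rw [a, mul_assoc _ _ p, b, ← mul_assoc, mul_assoc _ _ (ascProd s n), d]
  simp only [mul_assoc]

theorem HeckeSystem.mul_left_gt (hs : HeckeSystem h (n + 1) t s) {i j : ℕ} {p : H}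
    (hij : j < i) (hi : i < n) (hp : ∀ i, 1 < i → i < n + 1 → Commute (s i) p) (c : H) :
    s (i + 1) * (descProd h s j * p * ascProd s n * c) =
      descProd h s j * p * ascProd s n * (s i * c) := by
  have a := hs.mul_descProd_of_gt (i := i + 1) (j := j) (by omega) (by omega)
  have b := (hp (i + 1) (by omega) (by omega)).eq
  have d := hs.mul_ascProd_of_lt (j := n) (i := i) (by omega) (by omega) (by omega)
  simp only [← mul_assoc]
  rw [a, mul_assoc _ _ p, b, ← mul_assoc, mul_assoc _ _ (ascProd s n), d]
  simp only [mul_assoc]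

theorem HeckeSystem.descProd_shift_mul_ascProd (hs : HeckeSystem h (n + 1) t s) {j : ℕ}
    (hj : j < n) :
    descProd h (fun i => s (i + 1)) j * ascProd s n = ascProd s n * descProd h s j := by
  induction j with
  | zero => simp [descProd]
  | succ j ih =>
    rw [descProd, mul_assoc, ih (by omega), ← mul_assoc, sub_mul,
      hs.mul_ascProd_of_lt (by omega) hj (by omega), descProd, ← mul_assoc, mul_sub,
      smul_mul_assoc, one_mul, mul_smul_comm, mul_one]

/-- This is the origin of the formula `T_succ`. Apart from the `s_1` factors next to `p`, all
letters of the two words have index at least 2 and commute with `t` and `p`, so everything reduces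
to an identity between `t`, `p` and `s 1`. -/
theorem HeckeSystem.tau_mul_left (hs : HeckeSystem h (n + 1) t s) {j : ℕ} {p : H}
    (hj : j < n) (hp : ∀ i, 1 < i → i < n + 1 → Commute (s i) p)
    (hp' : Commute (s 1 * t * s 1) p) (c : H) :
    t * (descProd h s (j + 1) * p * ascProd s n * c) =
      descProd h s (j + 1) * p * ascProd s n * (t * c) +
        h • (t * ascProd s n * (descProd h s j * (p * c)) -
          t * p * ascProd s n * (descProd h s j * c)) := by
  obtain ⟨n, rfl⟩ : ∃ k, n = k + 1 := ⟨n - 1, by omega⟩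
  have l := hs.inv_mul (i := 1) le_rfl (by omega)
  have r := hs.mul_inv (i := 1) le_rfl (by omega)
  -- `t s_1 = s_1⁻¹ (s_1 t s_1)`, and the bracket commutes with `p`.
  have key : t * s 1 * p * (s 1 - h • 1) = (s 1 - h • 1) * p * s 1 * t := by
    calc t * s 1 * p * (s 1 - h • 1)
        = (s 1 - h • 1) * (s 1 * t * s 1 * p) * (s 1 - h • 1) := by
          simp only [← mul_assoc]; rw [l, one_mul]
      _ = (s 1 - h • 1) * p * s 1 * t * (s 1 * (s 1 - h • 1)) := by
          rw [hp'.eq]; simp only [← mul_assoc]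
      _ = _ := by rw [r, mul_one]
  have key' : t * ((s 1 - h • 1) * p * s 1) =
      (s 1 - h • 1) * p * s 1 * t + h • (t * s 1 * p - t * p * s 1) := by
    rw [← key]
    simp only [mul_sub, sub_mul, mul_smul_comm, smul_mul_assoc, mul_one, one_mul, mul_assoc]
    module
  have tA : Commute t (ascProd (fun i => s (i + 1)) n) :=
    commute_ascProd n fun i h₁ h₂ => hs.tau_comm (i + 1) (by omega) (by omega)
  have pA : Commute p (ascProd (fun i => s (i + 1)) n) :=
    commute_ascProd n fun i h₁ h₂ => (hp (i + 1) (by omega) (by omega)).symm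
  have tV : Commute t (descProd h (fun i => s (i + 1)) j) :=
    commute_descProd h j fun i h₁ h₂ => hs.tau_comm (i + 1) (by omega) (by omega)
  have pV : Commute p (descProd h (fun i => s (i + 1)) j) :=
    commute_descProd h j fun i h₁ h₂ => (hp (i + 1) (by omega) (by omega)).symm
  have VA := hs.descProd_shift_mul_ascProd hj
  have e₁ : t * ascProd s (n + 1) * (descProd h s j * (p * c)) =
      descProd h (fun i => s (i + 1)) j * (t * s 1 * p) *
        (ascProd (fun i => s (i + 1)) n * c) := by
    rw [mul_assoc t, ← mul_assoc (ascProd s (n + 1)), ← VA, ← mul_assoc t, ← mul_assoc t, tV.eq,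
      ascProd_succ']
    simp only [mul_assoc]
    rw [← mul_assoc p, pA.eq, mul_assoc]
  have e₂ : t * p * ascProd s (n + 1) * (descProd h s j * c) =
      descProd h (fun i => s (i + 1)) j * (t * p * s 1) *
        (ascProd (fun i => s (i + 1)) n * c) := by
    rw [mul_assoc (t * p), ← mul_assoc (ascProd s (n + 1)), ← VA, ← mul_assoc (t * p),
      ← mul_assoc (t * p), (tV.mul_left pV).eq, ascProd_succ']
    simp only [mul_assoc]
  have e₃ : t * (descProd h s (j + 1) * p * ascProd s (n + 1) * c) =
      descProd h (fun i => s (i + 1)) j * (t * ((s 1 - h • 1) * p * s 1)) *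
        (ascProd (fun i => s (i + 1)) n * c) := by
    rw [descProd_succ', ascProd_succ']
    simp only [← mul_assoc]
    rw [tV.eq]
  have e₄ : descProd h s (j + 1) * p * ascProd s (n + 1) * (t * c) =
      descProd h (fun i => s (i + 1)) j * ((s 1 - h • 1) * p * s 1 * t) *
        (ascProd (fun i => s (i + 1)) n * c) := by
    rw [descProd_succ', ascProd_succ']
    simp only [mul_assoc]
    rw [← mul_assoc t, tA.eq, mul_assoc]
  rw [e₁, e₂, e₃, e₄, key', ← sub_mul, ← mul_sub, ← smul_mul_assoc, ← mul_smul_comm, ← add_mul,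
    ← mul_add]

end LeftMultiplication

/-! ### The presented algebra: universal property, inclusion of rank `n` in rank `n + 1`, normal
words. -/

section Presented

variable {R : Type*} [CommRing R] {m : ℕ} (q : Rˣ) (v : Fin m → R) (n : ℕ)

/-- The parameter `q - q⁻¹` of the quadratic relation. -/
def qDiff (q : Rˣ) : R := (q : R) - ((q⁻¹ : Rˣ) : R)

/-- The polynomial `(X - v_1) ⋯ (X - v_m)`. -/
noncomputable def cycPoly (v : Fin m → R) : Polynomial R :=
  ∏ a, (Polynomial.X - Polynomial.C (v a))

theorem aeval_cycPoly {H : Type*} [Ring H] [Algebra R H] (t : H) :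
    Polynomial.aeval t (cycPoly v) =
      (List.ofFn fun a : Fin m => t - algebraMap R H (v a)).prod := by
  rw [cycPoly, ← List.prod_ofFn, map_list_prod, List.map_ofFn]
  congr 2
  funext a
  simp

/-- The element `τ`, or `0` if `n = 0`. -/
def genTau : CyclotomicHecke q v n := if h : 1 ≤ n then tau q v h else 0

/-- The element `σ_i`, or `0` if `i` is out of range. -/
def genSigma (i : ℕ) : CyclotomicHecke q v n :=
  if h : 1 ≤ i ∧ i < n then sigmaElt q v i h.1 h.2 else 0

theorem genTau_eq {n : ℕ} (h : 1 ≤ n) : genTau q v n = tau q v h := dif_pos h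

theorem genSigma_eq {n : ℕ} (i : ℕ) (h₁ : 1 ≤ i) (h₂ : i < n) :
    genSigma q v n i = sigmaElt q v i h₁ h₂ := dif_pos ⟨h₁, h₂⟩

theorem heckeSystem_gen : HeckeSystem (qDiff q) n (genTau q v n) (genSigma q v n) where
  braid i h₁ h₂ := by
    rw [genSigma_eq q v i h₁ (by omega), genSigma_eq q v (i + 1) (by omega) h₂]
    simpa only [map_mul, tau, sigmaElt] using
      RingQuot.mkAlgHom_rel R (Rel.braid (q := q) (v := v) i h₁ h₂)
  comm i j h₁ h₂ h₃ := by
    rw [genSigma_eq q v i h₁ (by omega), genSigma_eq q v j (by omega) h₃]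
    have hij : 1 < |(i : ℤ) - (j : ℤ)| := by
      rw [abs_sub_comm, lt_abs]
      left
      omega
    simpa only [map_mul, tau, sigmaElt] using
      RingQuot.mkAlgHom_rel R (Rel.comm (q := q) (v := v) i j h₁ (by omega) (by omega) h₃ hij)
  tau_braid h := by
    rw [genSigma_eq q v 1 le_rfl h, genTau_eq q v h.le]
    simpa only [map_mul, tau, sigmaElt] using RingQuot.mkAlgHom_rel R (Rel.tau_braid (q := q) (v := v) h)
  tau_comm i h₁ h₂ := by
    rw [genSigma_eq q v i h₁.le h₂, genTau_eq q v (by omega)]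
    simpa only [map_mul, tau, sigmaElt] using
      RingQuot.mkAlgHom_rel R (Rel.tau_comm (q := q) (v := v) i h₁ h₂)
  quadratic i h₁ h₂ := by
    rw [genSigma_eq q v i h₁ h₂, ← pow_two]
    exact sigmaElt_sq q v i h₁ h₂

theorem aeval_genTau (hn : 1 ≤ n) : Polynomial.aeval (genTau q v n) (cycPoly v) = 0 := by
  rw [genTau_eq q v hn, aeval_cycPoly]
  exact cyclotomic_eq q v hn

section Lift

variable {q v n} {H : Type*} [Ring H] [Algebra R H] {t : H} {s : ℕ → H}

/-- The algebra map from `H(m,1,n)` given by elements that satisfy the relations. -/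
noncomputable def liftHom (hs : HeckeSystem (qDiff q) n t s)
    (ht : 1 ≤ n → Polynomial.aeval t (cycPoly v) = 0) : CyclotomicHecke q v n →ₐ[R] H :=
  RingQuot.liftAlgHom R ⟨FreeAlgebra.lift R fun g => match g with
    | Gen.tau _ => t
    | Gen.sigma i _ _ => s i, by
    rintro x y (⟨i, h₁, h₂⟩ | ⟨i, j, hi₁, hi₂, hj₁, hj₂, hij⟩ | ⟨h⟩ | ⟨i, h₁, h₂⟩ |
      ⟨i, h₁, h₂⟩ | ⟨h⟩)
    · simpa only [map_mul, freeSigma, FreeAlgebra.lift_ι_apply] using hs.braid i h₁ h₂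
    · simp only [map_mul, freeSigma, FreeAlgebra.lift_ι_apply]
      rcases lt_abs.mp hij with hij | hij
      · exact (hs.comm j i hj₁ (by omega) hi₂).symm
      · exact hs.comm i j hi₁ (by omega) hj₂
    · simpa only [map_mul, freeSigma, freeTau, FreeAlgebra.lift_ι_apply] using hs.tau_braid h
    · simpa only [map_mul, freeSigma, freeTau, FreeAlgebra.lift_ι_apply] using
        hs.tau_comm i h₁ h₂
    · simpa only [map_pow, map_add, map_smul, map_one, freeSigma, FreeAlgebra.lift_ι_apply,
        pow_two, map_mul, qDiff] using hs.quadratic i h₁ h₂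
    · rw [map_zero, map_list_prod, List.map_ofFn, ← ht h, aeval_cycPoly]
      congr 2
      funext a
      simp only [Function.comp, map_sub, AlgHom.commutes, freeTau, FreeAlgebra.lift_ι_apply]⟩

theorem liftHom_tau (hs : HeckeSystem (qDiff q) n t s)
    (ht : 1 ≤ n → Polynomial.aeval t (cycPoly v) = 0) (hn : 1 ≤ n) :
    liftHom hs ht (genTau q v n) = t := by
  rw [genTau_eq q v hn, tau, liftHom, RingQuot.liftAlgHom_mkAlgHom_apply, freeTau,
    FreeAlgebra.lift_ι_apply]

theorem liftHom_sigma (hs : HeckeSystem (qDiff q) n t s)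
    (ht : 1 ≤ n → Polynomial.aeval t (cycPoly v) = 0) {i : ℕ} (h₁ : 1 ≤ i) (h₂ : i < n) :
    liftHom hs ht (genSigma q v n i) = s i := by
  rw [genSigma_eq q v i h₁ h₂, sigmaElt, liftHom, RingQuot.liftAlgHom_mkAlgHom_apply, freeSigma,
    FreeAlgebra.lift_ι_apply]

end Lift

theorem gen_induction {C : CyclotomicHecke q v n → Prop}
    (algebraMap : ∀ r, C (algebraMap R _ r)) (tau : 1 ≤ n → C (genTau q v n))
    (sigma : ∀ i, 1 ≤ i → i < n → C (genSigma q v n i))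
    (mul : ∀ a b, C a → C b → C (a * b)) (add : ∀ a b, C a → C b → C (a + b))
    (z : CyclotomicHecke q v n) : C z := by
  obtain ⟨z, rfl⟩ := RingQuot.mkAlgHom_surjective R (Rel q v n) z
  induction z using FreeAlgebra.induction with
  | grade0 r => rw [AlgHom.commutes]; exact algebraMap r
  | grade1 g =>
    cases g with
    | tau hn =>
      have := tau hn
      rw [genTau_eq q v hn] at this
      exact this
    | sigma i h₁ h₂ =>
      have := sigma i h₁ h₂
      rw [genSigma_eq q v i h₁ h₂] at this
      exact this
  | mul a b ha hb => rw [map_mul]; exact mul _ _ ha hb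
  | add a b ha hb => rw [map_add]; exact add _ _ ha hb

/-- The algebra map from `H(m,1,n)` to `H(m,1,n+1)`. -/
noncomputable def inclHom : CyclotomicHecke q v n →ₐ[R] CyclotomicHecke q v (n + 1) :=
  liftHom (heckeSystem_gen q v (n + 1)).mono fun _ => aeval_genTau q v (n + 1) (by omega)

theorem inclHom_tau (hn : 1 ≤ n) : inclHom q v n (genTau q v n) = genTau q v (n + 1) :=
  liftHom_tau _ _ hn

theorem inclHom_sigma {i : ℕ} (h₁ : 1 ≤ i) (h₂ : i < n) :
    inclHom q v n (genSigma q v n i) = genSigma q v (n + 1) i :=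
  liftHom_sigma _ _ h₁ h₂

variable {n}

theorem descInv_eq (j : ℕ) (hj : j < n) :
    descInv q v j hj = descProd (qDiff q) (genSigma q v n) j := by
  induction j with
  | zero => rfl
  | succ j ih => rw [descInv, descProd, ih, genSigma_eq q v (j + 1) (by omega) hj]; rfl

theorem asc_eq (j : ℕ) (hj : j < n) : asc q v j hj = ascProd (genSigma q v n) j := by
  induction j with
  | zero => rfl
  | succ j ih => rw [asc, ascProd, ih, genSigma_eq q v (j + 1) (by omega) hj]; rfl

theorem factor_eq (k : ℕ) (h₁ : 1 ≤ k) (h₂ : k ≤ n) (j : Fin k) (α : Fin m) :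
    factor q v k h₁ h₂ j α = descProd (qDiff q) (genSigma q v n) j * genTau q v n ^ (α : ℕ) *
      ascProd (genSigma q v n) (k - 1) := by
  rw [factor, descInv_eq, asc_eq, genTau_eq]

theorem inclHom_factor (k : ℕ) (h₁ : 1 ≤ k) (h₂ : k ≤ n) (j : Fin k) (α : Fin m) :
    inclHom q v n (factor q v k h₁ h₂ j α) = factor q v k h₁ (by omega) j α := by
  rw [factor_eq, factor_eq, map_mul, map_mul, map_pow, map_descProd, map_ascProd,
    inclHom_tau q v n (by omega)]
  congr 1
  · congr 1
    exact descProd_congr _ _ fun i hi hi' => inclHom_sigma q v n hi (by omega)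
  · exact ascProd_congr _ fun i hi hi' => inclHom_sigma q v n hi (by omega)

/-- The last choice gives the leftmost factor, so a normal word of rank `n + 1` is a word of
`R_{n+1}` times a normal word of rank `n`. -/
theorem normalWord_snoc (c : Choice m n) (j : Fin (n + 1)) (α : Fin m) :
    normalWord q v (Fin.snoc (α := fun i : Fin (n + 1) => Fin (i.val + 1) × Fin m) c (j, α)) =
      descProd (qDiff q) (genSigma q v (n + 1)) j * genTau q v (n + 1) ^ (α : ℕ) *
        ascProd (genSigma q v (n + 1)) n * inclHom q v n (normalWord q v c) := by
  rw [normalWord, List.ofFn_succ', List.concat_eq_append, List.reverse_append,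
    List.reverse_singleton, List.singleton_append, List.prod_cons]
  congr 1
  · rw [factor_eq, Fin.snoc_last]
    rfl
  · rw [normalWord, map_list_prod, List.map_reverse, List.map_ofFn]
    congr 3
    funext i
    rw [Function.comp, inclHom_factor, Fin.snoc_castSucc]
    rfl

end Presented

end CyclotomicHecke

namespace CyclotomicHecke

/-! ### Action of the words on the induced model. -/

namespace InducedModel

variable {R B M : Type*} [CommRing R] [Ring B] [Algebra R B] [AddCommGroup M] [Module R M]
  {h : R} {n : ℕ} {x y : B} {s : ℕ → B} {E : B →ₗ[R] B} {e : ℕ → B →ₗ[R] M}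
  {T : Module.End R M} {S : ℕ → Module.End R M}

theorem ascProd_apply (H : InducedModel h n x y s E e T S) {k : ℕ} (hk : k ≤ n) (b : B) :
    ascProd S k (e k b) = e 0 b := by
  induction k with
  | zero => rfl
  | succ k ih => rw [ascProd, Module.End.mul_apply, H.S_eq k b hk, ih (by omega)]

theorem descProd_apply (H : InducedModel h n x y s E e T S) {k : ℕ} (hk : k ≤ n) (b : B) :
    descProd h S k (e 0 b) = e k b := by
  induction k with
  | zero => rfl
  | succ k ih =>
    rw [descProd, Module.End.mul_apply, ih (by omega), LinearMap.sub_apply, H.S_succ k b hk,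
      LinearMap.smul_apply, Module.End.one_apply, add_sub_cancel_right]

end InducedModel

theorem HeckeSystem.descProd_mul_ascProd {R H : Type*} [CommRing R] [Ring H] [Algebra R H] {h : R}
    {n : ℕ} {t : H} {s : ℕ → H} (hs : HeckeSystem h n t s) {j : ℕ} (hj : j < n) :
    descProd h s j * ascProd s j = 1 := by
  have : ∀ j, j < n → ascProd s j * descProd h s j = 1 ∧ descProd h s j * ascProd s j = 1 := by
    intro j
    induction j with
    | zero => intro _; simp [descProd, ascProd]
    | succ j ih =>
      intro hj
      obtain ⟨ih₁, ih₂⟩ := ih (by omega)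
      constructor
      · rw [ascProd, mul_assoc, hs.mul_descProd_succ hj, ih₁]
      · rw [descProd, ascProd, mul_assoc, ← mul_assoc (descProd h s j), ih₂, one_mul,
          hs.inv_mul (by omega) hj]
  exact (this j hj).2

/-! ### The induced module of `H(m,1,n+1)` and the induction on `n`. -/

section Induction

open TensorProduct

variable {R : Type*} [CommRing R] {m : ℕ} (q : Rˣ) (v : Fin m → R) (n : ℕ)

/-- The algebra `R[X]/(f) ⊗ H(m,1,n)`, with `f = (X - v_1) ⋯ (X - v_m)`. -/
abbrev CoeffAlg : Type _ := AdjoinRoot (cycPoly v) ⊗[R] CyclotomicHecke q v n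

/-- The action of `τ` on the induced module. -/
noncomputable def indTau : Module.End R (Fin (n + 1) → CoeffAlg q v n) :=
  tauOp (qDiff q) n (AdjoinRoot.root (cycPoly v) ⊗ₜ 1) (1 ⊗ₜ genTau q v n)
    (fun i => 1 ⊗ₜ genSigma q v n i)
    (modelEval (cycPoly v) n (genTau q v n) (aeval_genTau q v n))

/-- The action of `σ_i` on the induced module. -/
noncomputable def indSigma : ℕ → Module.End R (Fin (n + 1) → CoeffAlg q v n) :=
  sigmaOp (qDiff q) n (fun i => 1 ⊗ₜ genSigma q v n i)

theorem inducedModel : InducedModel (qDiff q) n (AdjoinRoot.root (cycPoly v) ⊗ₜ 1)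
    (1 ⊗ₜ genTau q v n) (fun i => 1 ⊗ₜ genSigma q v n i)
    (modelEval (cycPoly v) n (genTau q v n) (aeval_genTau q v n))
    (coordVec R n) (indTau q v n) (indSigma q v n) :=
  ((heckeSystem_gen q v n).inducedCoeff (cycPoly v) (aeval_genTau q v n)).model

theorem aeval_indTau : Polynomial.aeval (indTau q v n) (cycPoly v) = 0 := by
  refine (inducedModel q v n).aeval_T_eq_zero _ ?_ (fun hn => ?_) fun hn b => ?_
  · have := Polynomial.aeval_algHom_apply (Algebra.TensorProduct.includeLeft :
      AdjoinRoot (cycPoly v) →ₐ[R] CoeffAlg q v n) (AdjoinRoot.root (cycPoly v)) (cycPoly v)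
    rw [AdjoinRoot.aeval_eq, AdjoinRoot.mk_self, map_zero] at this
    exact this
  · have := Polynomial.aeval_algHom_apply (Algebra.TensorProduct.includeRight :
      CyclotomicHecke q v n →ₐ[R] CoeffAlg q v n) (genTau q v n) (cycPoly v)
    rw [aeval_genTau q v n hn, map_zero] at this
    exact this
  · rw [modelEval, dif_pos hn]
    exact exists_sub_evalOp_eq _ b

/-- The representation of `H(m,1,n+1)` on the induced module. -/
noncomputable def indRep :
    CyclotomicHecke q v (n + 1) →ₐ[R] Module.End R (Fin (n + 1) → CoeffAlg q v n) :=
  liftHom (inducedModel q v n).heckeSystem fun _ => aeval_indTau q v n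

theorem indRep_tau : indRep q v n (genTau q v (n + 1)) = indTau q v n :=
  liftHom_tau _ _ (by omega)

theorem indRep_sigma {i : ℕ} (h₁ : 1 ≤ i) (h₂ : i < n + 1) :
    indRep q v n (genSigma q v (n + 1) i) = indSigma q v n i :=
  liftHom_sigma _ _ h₁ h₂

/-- On `e_n(1 ⊗ c)` the correction term of `τ` vanishes, because `E` fixes `1 ⊗ c`; the `σ_i` with
`i < n` act there without correction. -/
theorem indRep_inclHom (z c : CyclotomicHecke q v n) :
    indRep q v n (inclHom q v n z) (coordVec R n n (1 ⊗ₜ c)) = coordVec R n n (1 ⊗ₜ (z * c)) := by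
  have M := inducedModel q v n
  induction z using gen_induction generalizing c with
  | algebraMap r =>
    rw [AlgHom.commutes, AlgHom.commutes, Module.algebraMap_end_apply, ← Algebra.smul_def,
      TensorProduct.tmul_smul, map_smul]
  | tau hn =>
    obtain ⟨k, rfl⟩ : ∃ k, n = k + 1 := ⟨n - 1, by omega⟩
    rw [inclHom_tau q v _ hn, indRep_tau, M.T_succ k _ (by omega)]
    simp [modelEval, evalOp_tmul]
  | sigma i h₁ h₂ =>
    rw [inclHom_sigma q v n h₁ h₂, indRep_sigma q v n h₁ (by omega), M.S_lt i n _ h₁ h₂ le_rfl,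
      Algebra.TensorProduct.tmul_mul_tmul, one_mul]
  | mul a b ha hb => rw [map_mul, map_mul, Module.End.mul_apply, hb, ha, mul_assoc]
  | add a b ha hb =>
    rw [map_add, map_add, LinearMap.add_apply, hb, ha, add_mul, TensorProduct.tmul_add, map_add]

/-- The ascending word moves `e_n` to `e_0`, where `τ` multiplies by `X`; the descending word then
moves `e_0` to `e_j`. -/
theorem indRep_factor {j : ℕ} (hj : j ≤ n) (α : ℕ) (c : CyclotomicHecke q v n) :
    indRep q v n (descProd (qDiff q) (genSigma q v (n + 1)) j * genTau q v (n + 1) ^ α *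
      ascProd (genSigma q v (n + 1)) n) (coordVec R n n (1 ⊗ₜ c)) =
      coordVec R n j ((AdjoinRoot.root (cycPoly v) ^ α) ⊗ₜ c) := by
  have M := inducedModel q v n
  have d : indRep q v n (descProd (qDiff q) (genSigma q v (n + 1)) j) =
      descProd (qDiff q) (indSigma q v n) j :=
    (map_descProd (H' := Module.End R (Fin (n + 1) → CoeffAlg q v n)) (indRep q v n) _ _ j).trans
      (descProd_congr _ j fun i h₁ h₂ => indRep_sigma q v n h₁ (by omega))
  have a : indRep q v n (ascProd (genSigma q v (n + 1)) n) = ascProd (indSigma q v n) n :=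
    (map_ascProd (H' := Module.End R (Fin (n + 1) → CoeffAlg q v n)) (indRep q v n) _ n).trans
      (ascProd_congr n fun i h₁ h₂ => indRep_sigma q v n h₁ (by omega))
  rw [map_mul, map_mul, map_pow, d, a, indRep_tau, Module.End.mul_apply, Module.End.mul_apply,
    M.ascProd_apply le_rfl, M.pow_T_apply, M.descProd_apply hj]
  simp

/-- The map `e_j(p ⊗ c) ↦ σ_j⁻¹ ⋯ σ_1⁻¹ p(τ) σ_1 ⋯ σ_n c`. -/
noncomputable def indMap : (Fin (n + 1) → CoeffAlg q v n) →ₗ[R] CyclotomicHecke q v (n + 1) :=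
  sumOp n fun j => TensorProduct.lift <|
    (LinearMap.mul R (CyclotomicHecke q v (n + 1))).compl₁₂
      (LinearMap.mulLeft R (descProd (qDiff q) (genSigma q v (n + 1)) j) ∘ₗ
        LinearMap.mulRight R (ascProd (genSigma q v (n + 1)) n) ∘ₗ
          (rootHom (cycPoly v) _ (aeval_genTau q v (n + 1) (by omega))).toLinearMap)
      (inclHom q v n).toLinearMap

theorem indMap_coordVec {j : ℕ} (hj : j ≤ n) (p : AdjoinRoot (cycPoly v))
    (c : CyclotomicHecke q v n) :
    indMap q v n (coordVec R n j (p ⊗ₜ c)) =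
      descProd (qDiff q) (genSigma q v (n + 1)) j *
        rootHom (cycPoly v) _ (aeval_genTau q v (n + 1) (by omega)) p *
        ascProd (genSigma q v (n + 1)) n * inclHom q v n c := by
  rw [indMap, sumOp_coordVec hj]
  simp [mul_assoc]

theorem indMap_sigma {i : ℕ} (h₁ : 1 ≤ i) (h₂ : i < n + 1) (φ : Fin (n + 1) → CoeffAlg q v n) :
    indMap q v n (indSigma q v n i φ) = genSigma q v (n + 1) i * indMap q v n φ := by
  have M := inducedModel q v n
  have G := heckeSystem_gen q v (n + 1)
  suffices indMap q v n ∘ₗ indSigma q v n i =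
      LinearMap.mulLeft R (genSigma q v (n + 1) i) ∘ₗ indMap q v n from LinearMap.congr_fun this φ
  refine coordVec_hom_ext fun j b hj => ?_
  rw [LinearMap.comp_apply, LinearMap.comp_apply, LinearMap.mulLeft_apply]
  obtain ⟨i, rfl⟩ : ∃ k, i = k + 1 := ⟨i - 1, by omega⟩
  induction b using TensorProduct.induction_on with
  | zero => simp
  | add b b' hb hb' => simp only [map_add, hb, hb', mul_add]
  | tmul p c =>
    have hp : ∀ i, 1 < i → i < n + 1 → Commute (genSigma q v (n + 1) i)
        (rootHom (cycPoly v) _ (aeval_genTau q v (n + 1) (by omega)) p) := fun i h₁ h₂ =>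
      commute_rootHom _ (G.tau_comm i h₁ h₂).symm p
    rcases (show i + 1 < j ∨ j = i + 1 ∨ j = i ∨ j < i by omega) with hij | rfl | rfl | hij
    · rw [M.S_lt _ _ _ h₁ hij hj, Algebra.TensorProduct.tmul_mul_tmul, one_mul,
        indMap_coordVec q v n hj, indMap_coordVec q v n hj, G.mul_left_lt h₁ hij hj hp, map_mul,
        inclHom_sigma q v n h₁ (by omega)]
    · rw [M.S_eq _ _ (by omega), indMap_coordVec q v n hj, indMap_coordVec q v n (by omega)]
      simp only [← mul_assoc]
      rw [G.mul_descProd_succ h₂]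
    · rw [M.S_succ _ _ (by omega), map_add, map_smul, indMap_coordVec q v n hj,
        indMap_coordVec q v n (by omega)]
      simp only [← mul_assoc]
      rw [HeckeSystem.mul_descProd (h := qDiff q)]
      simp only [add_mul, smul_mul_assoc]
    · rw [M.S_gt _ _ _ hij (by omega), Algebra.TensorProduct.tmul_mul_tmul, one_mul,
        indMap_coordVec q v n hj, indMap_coordVec q v n hj, G.mul_left_gt hij (by omega) hp,
        map_mul, inclHom_sigma q v n (by omega) (by omega)]

/-- For positive `j` this matches `T_succ` with `HeckeSystem.tau_mul_left`; the term with `E` fits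
since evaluating `p` at `τ` in rank `n` and then including agrees with evaluating it in rank `n +
1`. -/
theorem indMap_tau (φ : Fin (n + 1) → CoeffAlg q v n) :
    indMap q v n (indTau q v n φ) = genTau q v (n + 1) * indMap q v n φ := by
  have M := inducedModel q v n
  have G := heckeSystem_gen q v (n + 1)
  suffices indMap q v n ∘ₗ indTau q v n =
      LinearMap.mulLeft R (genTau q v (n + 1)) ∘ₗ indMap q v n from LinearMap.congr_fun this φ
  refine coordVec_hom_ext fun j b hj => ?_
  rw [LinearMap.comp_apply, LinearMap.comp_apply, LinearMap.mulLeft_apply]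
  induction b using TensorProduct.induction_on with
  | zero => simp
  | add b b' hb hb' => simp only [map_add, hb, hb', mul_add]
  | tmul p c =>
    have ht := aeval_genTau q v (n + 1) (by omega)
    rcases Nat.eq_zero_or_pos j with rfl | hj0
    · rw [M.T_zero, Algebra.TensorProduct.tmul_mul_tmul, one_mul, indMap_coordVec q v n hj,
        indMap_coordVec q v n hj, map_mul, rootHom_root]
      simp [descProd, mul_assoc]
    obtain ⟨j, rfl⟩ : ∃ k, j = k + 1 := ⟨j - 1, by omega⟩
    have hn : 1 ≤ n := by omega
    have hp : ∀ i, 1 < i → i < n + 1 → Commute (genSigma q v (n + 1) i)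
        (rootHom (cycPoly v) _ ht p) := fun i h₁ h₂ =>
      commute_rootHom _ (G.tau_comm i h₁ h₂).symm p
    have hp' : Commute (genSigma q v (n + 1) 1 * genTau q v (n + 1) * genSigma q v (n + 1) 1)
        (rootHom (cycPoly v) _ ht p) := by
      refine commute_rootHom _ ?_ p
      have := G.tau_braid (by omega)
      simp only [Commute, SemiconjBy, mul_assoc] at this ⊢
      exact this.symm
    have w : descProd (qDiff q) (fun i => (1 : AdjoinRoot (cycPoly v)) ⊗ₜ[R] genSigma q v n i) j =
        1 ⊗ₜ descProd (qDiff q) (genSigma q v n) j :=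
      (map_descProd (Algebra.TensorProduct.includeRight :
        CyclotomicHecke q v n →ₐ[R] CoeffAlg q v n) _ _ _).symm
    have w' : inclHom q v n (descProd (qDiff q) (genSigma q v n) j) =
        descProd (qDiff q) (genSigma q v (n + 1)) j := by
      rw [map_descProd]
      exact descProd_congr _ _ fun i h₁ h₂ => inclHom_sigma q v n h₁ (by omega)
    have ip : inclHom q v n (rootHom (cycPoly v) _ (aeval_genTau q v n hn) p) =
        rootHom (cycPoly v) _ ht p := by
      induction p using AdjoinRoot.induction_on with
      | ih p =>
        rw [rootHom_mk, rootHom_mk, ← inclHom_tau q v n hn, Polynomial.aeval_algHom_apply]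
    rw [M.T_succ _ _ (by omega), indMap_coordVec q v n hj, G.tau_mul_left (by omega) hp hp', w,
      modelEval, dif_pos hn, evalOp_tmul]
    simp only [mul_sub, map_sub, Algebra.TensorProduct.tmul_mul_tmul, one_mul, mul_one, map_add,
      map_smul, indMap_coordVec q v n hj, indMap_coordVec q v n (Nat.zero_le n), map_mul,
      rootHom_root, w', ip, inclHom_tau q v n hn]
    simp only [descProd, one_mul]

theorem indMap_indRep (z : CyclotomicHecke q v (n + 1)) (φ : Fin (n + 1) → CoeffAlg q v n) :
    indMap q v n (indRep q v n z φ) = z * indMap q v n φ := by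
  induction z using gen_induction generalizing φ with
  | algebraMap r =>
    rw [AlgHom.commutes, Module.algebraMap_end_apply, map_smul, Algebra.smul_def]
  | tau hn => rw [indRep_tau, indMap_tau]
  | sigma i h₁ h₂ => rw [indRep_sigma q v n h₁ h₂, indMap_sigma q v n h₁ h₂]
  | mul a b ha hb => rw [map_mul, Module.End.mul_apply, ha, hb, mul_assoc]
  | add a b ha hb => rw [map_add, LinearMap.add_apply, map_add, ha, hb, add_mul]

/-- By equivariance it suffices that `e_n(1 ⊗ 1)` maps to `1`. -/
theorem indMap_surjective : Function.Surjective (indMap q v n) := fun z =>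
  ⟨indRep q v n z (coordVec R n n (1 ⊗ₜ 1)), by
    rw [indMap_indRep, indMap_coordVec q v n le_rfl, map_one, map_one, mul_one, mul_one,
      (heckeSystem_gen q v (n + 1)).descProd_mul_ascProd (by omega), mul_one]⟩

theorem monic_cycPoly : (cycPoly v).Monic := Polynomial.monic_prod_X_sub_C _ _

theorem natDegree_cycPoly [Nontrivial R] : (cycPoly v).natDegree = m := by
  rw [cycPoly, Polynomial.natDegree_finsetProd_X_sub_C_eq_card, Finset.card_univ, Fintype.card_fin]

theorem exists_basis_zero : ∃ b : Module.Basis (Choice m 0) R (CyclotomicHecke q v 0),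
    ⇑b = normalWord q v := by
  -- In rank 0 all relations are vacuous, so zeros define an algebra map to `R`, a left inverse of
  -- the structure map.
  have hs : HeckeSystem (qDiff q) 0 (0 : R) (fun _ => 0) :=
    ⟨by omega, by omega, by omega, by omega, by omega⟩
  have inj : Function.Injective (Algebra.linearMap R (CyclotomicHecke q v 0)) :=
    Function.LeftInverse.injective (g := liftHom (v := v) hs (by omega)) fun r => by
      rw [Algebra.linearMap_apply, AlgHom.commutes]
      rfl
  have surj : Function.Surjective (Algebra.linearMap R (CyclotomicHecke q v 0)) := fun z => by
    induction z using gen_induction with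
    | algebraMap r => exact ⟨r, rfl⟩
    | tau hn => omega
    | sigma i h₁ h₂ => omega
    | mul a b ha hb =>
      obtain ⟨r, rfl⟩ := ha
      obtain ⟨r', rfl⟩ := hb
      exact ⟨r * r', map_mul (algebraMap R _) r r'⟩
    | add a b ha hb =>
      obtain ⟨r, rfl⟩ := ha
      obtain ⟨r', rfl⟩ := hb
      exact ⟨r + r', map_add _ r r'⟩
  have bij : Function.Bijective (Algebra.linearMap R (CyclotomicHecke q v 0)) := ⟨inj, surj⟩
  refine ⟨(Module.Basis.singleton (Choice m 0) R).map (LinearEquiv.ofBijective _ bij), ?_⟩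
  funext c
  rw [Module.Basis.map_apply, Module.Basis.singleton_apply, LinearEquiv.ofBijective_apply,
    Algebra.linearMap_apply, map_one, normalWord]
  simp

theorem exists_basis_succ [Nontrivial R]
    (H : ∃ b : Module.Basis (Choice m n) R (CyclotomicHecke q v n), ⇑b = normalWord q v) :
    ∃ b : Module.Basis (Choice m (n + 1)) R (CyclotomicHecke q v (n + 1)),
      ⇑b = normalWord q v := by
  obtain ⟨b, hb⟩ := H
  obtain ⟨bA, hbA⟩ : ∃ bA : Module.Basis (Fin m) R (AdjoinRoot (cycPoly v)),
      ∀ α, bA α = AdjoinRoot.root (cycPoly v) ^ (α : ℕ) := by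
    refine ⟨(AdjoinRoot.powerBasis' (monic_cycPoly v)).basis.reindex
      (finCongr (natDegree_cycPoly v)), fun α => ?_⟩
    rw [Module.Basis.reindex_apply, PowerBasis.basis_eq_pow]
    rfl
  set bM : Module.Basis (Σ _ : Fin (n + 1), Fin m × Choice m n) R (Fin (n + 1) → CoeffAlg q v n) :=
    Pi.basis fun _ => bA.tensorProduct b with hbM
  have bM_apply : ∀ j α c, bM ⟨j, α, c⟩ =
      coordVec R n j ((AdjoinRoot.root (cycPoly v) ^ (α : ℕ)) ⊗ₜ normalWord q v c) := by
    intro j α c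
    rw [hbM, Pi.basis_apply, Module.Basis.tensorProduct_apply, hbA, hb, coordVec_apply]
  have map_bM : ∀ j α c, indMap q v n (bM ⟨j, α, c⟩) =
      normalWord q v
        (Fin.snoc (α := fun i : Fin (n + 1) => Fin (i.val + 1) × Fin m) c (j, α)) := by
    intro j α c
    rw [bM_apply, indMap_coordVec q v n (by omega), normalWord_snoc, map_pow, rootHom_root]
  have inj : Function.Injective (indMap q v n) := by
    -- Acting on `e_n(1 ⊗ 1)` inverts `indMap` on the left: the rank `n` part of a normal word `u c`
    -- gives `e_n(1 ⊗ c)`, and `u` then gives `e_j(X^α ⊗ c)`.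
    have : (LinearMap.applyₗ (coordVec R n n (1 ⊗ₜ 1)) ∘ₗ (indRep q v n).toLinearMap) ∘ₗ
        indMap q v n = LinearMap.id := by
      refine bM.ext fun ⟨j, α, c⟩ => ?_
      rw [LinearMap.comp_apply, map_bM, normalWord_snoc, LinearMap.comp_apply,
        LinearMap.applyₗ_apply_apply, AlgHom.toLinearMap_apply, map_mul, Module.End.mul_apply,
        indRep_inclHom, mul_one, indRep_factor q v n (by omega), LinearMap.id_apply, bM_apply]
    exact Function.LeftInverse.injective (g := fun z => indRep q v n z (coordVec R n n (1 ⊗ₜ 1)))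
      fun φ => LinearMap.congr_fun this φ
  have bij : Function.Bijective (indMap q v n) := ⟨inj, indMap_surjective q v n⟩
  let eq : (Σ _ : Fin (n + 1), Fin m × Choice m n) ≃ Choice m (n + 1) :=
    ((Equiv.sigmaEquivProd _ _).trans (Equiv.prodAssoc _ _ _).symm).trans
      (Fin.snocEquiv fun i : Fin (n + 1) => Fin (i.val + 1) × Fin m)
  refine ⟨(bM.map (LinearEquiv.ofBijective _ bij)).reindex eq, ?_⟩
  funext c
  obtain ⟨⟨j, α, c⟩, rfl⟩ := eq.surjective c
  rw [Module.Basis.reindex_apply, Equiv.symm_apply_apply, Module.Basis.map_apply,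
    LinearEquiv.ofBijective_apply, map_bM]
  rfl

theorem exists_basis [Nontrivial R] :
    ∃ b : Module.Basis (Choice m n) R (CyclotomicHecke q v n), ⇑b = normalWord q v := by
  induction n with
  | zero => exact exists_basis_zero q v
  | succ n ih => exact exists_basis_succ q v n ih

end Induction

end CyclotomicHecke

theorem mainTheorem10 {R : Type*} [CommRing R] (m n : ℕ) (q : Rˣ) (v : Fin m → R)
    (x : CyclotomicHecke q v n) :
    ∃! a : CyclotomicHecke.Choice m n → R,
      x = ∑ c : CyclotomicHecke.Choice m n, a c • CyclotomicHecke.normalWord q v c := by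
  -- Over the zero ring `cycPoly v` need not have degree `m`, but there everything is trivial.
  rcases subsingleton_or_nontrivial R with hR | hR
  · have : Subsingleton (CyclotomicHecke q v n) := Module.subsingleton R _
    exact ⟨0, Subsingleton.elim _ _, fun _ _ => Subsingleton.elim _ _⟩
  obtain ⟨b, hb⟩ := CyclotomicHecke.exists_basis q v n
  refine ⟨b.repr x, ?_, fun a ha => ?_⟩
  · simp only [← hb]
    exact (b.sum_repr x).symm
  · simp only [← hb] at ha
    rw [ha]
    funext c
    simp [Finsupp.single_apply]
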